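/- **Setting.** Let $N\ge 1$, let $e_1,\dots,e_N\in\mathbb R^2$ be distinct unit vectors, $J_i=[0,\infty)e_i$, $J_i^*=J_i\setminus\{0\}$ and $J=\bigcup_i J_i$, with the geodesic distance $d(x,y)=|x-y|$ if $x,y$ lie on a common branch and $d(x,y)=|x|+|y|$ otherwise. Let $0<T<\infty$ and $J_T=(0,T)\times J$. Let $L_1,\dots,L_N\in C^2(\mathbb R)$ satisfy $L_i''\ge\gamma$ for some constant $\gamma>0$, and put $$H_i(p)=\sup_{q\in\mathbb R}\,(pq-L_i(q)),\qquad H_i^-(p)=\sup_{q\le 0}\,(pq-L_i(q)).$$ *Super-solutions.* Let $C^1_*(J_T)$ be the set of continuous $\phi:J_T\to\mathbb R$ whose restriction to $(0,T)\times J_i$ is $C^1$ (up to $x=0$) for every $i$; write $\phi_x^i$ for the derivative along $J_i$ with respect to $x_i$, where $x=x_ie_i$, $x_i\ge0$. A function $u:[0,T)\times J\to\mathbb R$ is a super-solution on $J_T$ of the Hamilton–Jacobi equation $u_t+H(x,u_x)=0$ if it is lower semi-continuous and if, whenever $\phi\in C^1_*(J_T)$, $(t,x)\in J_T$, $\phi(t,x)=u(t,x)$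 and $\phi\le u$ on the intersection of $J_T$ with some ball centred at $(t,x)$, $$\phi_t(t,x)+H_i(\phi^i_x(t,x))\ge 0\ \text{ if } x\in J_i^*,\qquad \phi_t(t,0)+\max_{1\le i\le N}H_i^-(\phi^i_x(t,0))\ge 0\ \text{ if } x=0.$$ *Control problem.* Put $A(x)=\mathbb Re_i$ if $x\in J_i^*$ and $A(0)=\bigcup_i[0,\infty)e_i$. For $s\le t$ and $x,y\in J$, let $\mathcal A(s,y;t,x)$ be the set of $X\in W^{1,1}([s,t];\mathbb R^2)$ with $X(\tau)\in J$ for all $\tau\in(s,t)$, $\dot X(\tau)\in A(X(\tau))$ for a.e. $\tau\in(s,t)$, $X(s)=y$ and $X(t)=x$. For $P=pe_i\in A(x)$ put $L(x,P)=L_i(p)$ if $x\in J_i^*$, and $L(0,P)=\min_j L_j(p)$ (with $p\ge0$). Define, with values in $[-\infty,+\infty]$, $$\mathcal D(s,y;t,x)=\inf_{X\in\mathcal A(s,y;t,x)}\int_s^tL(X(\tau),\dot X(\tau))\,d\tau\quad(s<t),\qquad \mathcal D(t,y;t,x)=\begin{cases}0&y=x\\+\infty&y\ne x,\end{cases}$$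 and, for $u_0:J\to\mathbb R$, $$u_{\mathrm{oc}}(t,x)=\inf_{y\in J,\ X\in\mathcal A(0,y;t,x)}\Big\{u_0(y)+\int_0^tL(X(\tau),\dot X(\tau))\,d\tau\Big\}.$$ **Proposition (super-optimality of super-solutions).** Let $u:[0,T)\times J\to\mathbb R$ be a super-solution on $J_T$ of $u_t+H(x,u_x)=0$ such that, for some $\sigma>0$, $u(t,x)\ge-\sigma(1+d(x,0))$ for all $(t,x)\in J_T$. Then for all $(t,x)\in J_T$ and all $s\in(0,t]$, $$u(t,x)\ \ge\ \inf_{y\in J}\{u(s,y)+\mathcal D(s,y;t,x)\}.$$ If moreover $u_0:J\to\mathbb R$ is Lipschitz continuous and $u(0,x)\ge u_0(x)$ for all $x\in J$, then $u\ge u_{\mathrm{oc}}$ on $[0,T)\times J$. -/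

import Mathlib

open Set MeasureTheory

namespace JunctionHJ

noncomputable section

/-- The Euclidean plane. -/
abbrev Plane : Type := EuclideanSpace ℝ (Fin 2)

variable {N : ℕ}

/-! ### The junction -/

/-- The closed branch `J_i = [0, ∞) e_i`. -/
def branch (e : Fin N → Plane) (i : Fin N) : Set Plane :=
  {x | ∃ r : ℝ, 0 ≤ r ∧ x = r • e i}

/-- The open branch `J_i^* = J_i \ {0}`. -/
def openBranch (e : Fin N → Plane) (i : Fin N) : Set Plane :=
  branch e i \ {0}

/-- The junction `J`, the union of the branches. -/
def junction (e : Fin N → Plane) : Set Plane :=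
  ⋃ i, branch e i

open Classical in
/-- The geodesic distance on the junction. -/
def geoDist (e : Fin N → Plane) (x y : Plane) : ℝ :=
  if ∃ i, x ∈ branch e i ∧ y ∈ branch e i then ‖x - y‖ else ‖x‖ + ‖y‖

/-- `J_T = (0, T) × J`. -/
def openCylinder (e : Fin N → Plane) (T : ℝ) : Set (ℝ × Plane) :=
  Ioo 0 T ×ˢ junction e

/-- `[0, T) × J`. -/
def cylinder (e : Fin N → Plane) (T : ℝ) : Set (ℝ × Plane) :=
  Ico 0 T ×ˢ junction e

/-! ### Lagrangians and Hamiltonians -/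

/-- The Lagrangians are `C²` and uniformly convex, with a common constant `γ > 0`. -/
def UniformlyConvexLagrangians (L : Fin N → ℝ → ℝ) : Prop :=
  ∃ γ : ℝ, 0 < γ ∧ ∀ i, ContDiff ℝ 2 (L i) ∧ ∀ q : ℝ, γ ≤ iteratedDeriv 2 (L i) q

/-- The Legendre–Fenchel transform `H_i(p) = sup_{q ∈ ℝ} (p q - L_i(q))`. -/
def hamiltonian (L : Fin N → ℝ → ℝ) (i : Fin N) (p : ℝ) : ℝ :=
  ⨆ q : ℝ, (p * q - L i q)

/-- `H_i^-(p) = sup_{q ≤ 0} (p q - L_i(q))`. -/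
def hamiltonianMinus (L : Fin N → ℝ → ℝ) (i : Fin N) (p : ℝ) : ℝ :=
  ⨆ q : Iic (0 : ℝ), (p * (q : ℝ) - L i (q : ℝ))

/-- The Hamiltonian at the junction point, `max_i H_i^-(p_i)`. -/
def junctionHamiltonian (L : Fin N → ℝ → ℝ) (p : Fin N → ℝ) : ℝ :=
  ⨆ i, hamiltonianMinus L i (p i)

/-! ### Test functions and viscosity super-solutions

Functions on `[0, T) × J` or `(0, T) × J` are represented by functions `ℝ → Plane → ℝ`, of which
only the values on these sets are used. -/

/-- The class `C^1_*(J_T)`: continuous on `J_T`, and `C^1` on `(0, T) × J_i` (up to the boundary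
point `0` of `J_i`) for every `i`. -/
def IsTestFunction (e : Fin N → Plane) (T : ℝ) (φ : ℝ → Plane → ℝ) : Prop :=
  ContinuousOn (Function.uncurry φ) (openCylinder e T) ∧
  ∀ i, ContDiffOn ℝ 1 (fun p : ℝ × ℝ => φ p.1 (p.2 • e i)) (Ioo 0 T ×ˢ Ici 0)

/-- The time derivative `φ_t(t, x)`. -/
def timeDeriv (φ : ℝ → Plane → ℝ) (t : ℝ) (x : Plane) : ℝ :=
  deriv (fun s => φ s x) t

/-- The derivative `φ_x^i` along the branch `J_i` at the point `(t, r e_i)`, `r ≥ 0`; it is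
one-sided at `r = 0`. -/
def branchDeriv (e : Fin N → Plane) (φ : ℝ → Plane → ℝ) (i : Fin N) (t r : ℝ) : ℝ :=
  derivWithin (fun ρ => φ t (ρ • e i)) (Ici 0) r

/-- `φ` touches `u` from below at `(t, x)`: equality there, and `φ ≤ u` on `B((t, x), r) ∩ J_T` for
some `r > 0`. -/
def TouchesFromBelow (e : Fin N → Plane) (T : ℝ) (φ u : ℝ → Plane → ℝ) (t : ℝ) (x : Plane) :
    Prop :=
  φ t x = u t x ∧
  ∃ r : ℝ, 0 < r ∧ ∀ s y, (s, y) ∈ openCylinder e T → |s - t| < r → geoDist e y x < r →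
    φ s y ≤ u s y

/-- Viscosity super-solutions on `J_T` of `u_t + H(x, u_x) = 0`. -/
structure IsSuperSolution (e : Fin N → Plane) (L : Fin N → ℝ → ℝ) (T : ℝ)
    (u : ℝ → Plane → ℝ) : Prop where
  lowerSemicontinuousOn : LowerSemicontinuousOn (Function.uncurry u) (cylinder e T)
  /-- The inequality at the points `(t, r e_i)` of the open branches. -/
  on_branch : ∀ φ, IsTestFunction e T φ → ∀ t ∈ Ioo 0 T, ∀ i, ∀ r : ℝ, 0 < r →
    TouchesFromBelow e T φ u t (r • e i) →
    0 ≤ timeDeriv φ t (r • e i) + hamiltonian L i (branchDeriv e φ i t r)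
  /-- The inequality at the junction point. -/
  at_junction : ∀ φ, IsTestFunction e T φ → ∀ t ∈ Ioo 0 T,
    TouchesFromBelow e T φ u t 0 →
    0 ≤ timeDeriv φ t 0 + junctionHamiltonian L (fun i => branchDeriv e φ i t 0)

/-- Super-solutions of the Cauchy problem with initial datum `u₀`. -/
def IsCauchySuperSolution (e : Fin N → Plane) (L : Fin N → ℝ → ℝ) (T : ℝ) (u₀ : Plane → ℝ)
    (u : ℝ → Plane → ℝ) : Prop :=
  IsSuperSolution e L T u ∧ ∀ x ∈ junction e, u₀ x ≤ u 0 x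

/-- Lipschitz continuity on the junction. -/
def LipschitzOnJunction (e : Fin N → Plane) (u₀ : Plane → ℝ) : Prop :=
  ∃ K : ℝ, ∀ x ∈ junction e, ∀ y ∈ junction e, |u₀ x - u₀ y| ≤ K * geoDist e x y

/-! ### The optimal control problem -/

/-- The set `A(x)` of admissible controls: `ℝ e_i` if `x ∈ J_i^*`, and `⋃_i ℝ⁺ e_i` if `x = 0`. -/
def controlSet (e : Fin N → Plane) (x : Plane) : Set Plane :=
  {P | (∃ i, x ∈ openBranch e i ∧ ∃ p : ℝ, P = p • e i) ∨
    (x = 0 ∧ ∃ i, ∃ p : ℝ, 0 ≤ p ∧ P = p • e i)}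

/-- The admissible trajectories from `(s, y)` to `(t, x)`. The elements of `W^{1,1}([s, t])` are the
absolutely continuous curves, and their weak derivative is the derivative almost everywhere. -/
def trajectories (e : Fin N → Plane) (s : ℝ) (y : Plane) (t : ℝ) (x : Plane) :
    Set (ℝ → Plane) :=
  {X | AbsolutelyContinuousOnInterval X s t ∧
    (∀ τ ∈ Ioo s t, X τ ∈ junction e) ∧
    (∀ᵐ τ ∂(volume.restrict (Ioo s t)), deriv X τ ∈ controlSet e (X τ)) ∧
    X s = y ∧ X t = x}

open Classical in
/-- The Lagrangian on the junction: for `P = p e_i ∈ A(x)` it is `L_i(p)` if `x ∈ J_i^*` (then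
`p = ⟪e_i, P⟫`, and exactly one summand below is present), and `min_j L_j(p)` if `x = 0` (then
`p ≥ 0`, so that `p = ‖P‖`). -/
def junctionLagrangian (e : Fin N → Plane) (L : Fin N → ℝ → ℝ) (x P : Plane) : ℝ :=
  if x = 0 then ⨅ j, L j ‖P‖
  else ∑ i, if x ∈ openBranch e i then L i (inner ℝ (e i) P) else 0

open Classical in
/-- The cost `∫_s^t L(X, Ẋ) dτ` of a trajectory. The integrand is bounded from below for uniformly
convex Lagrangians, so that the integral is `+∞` when the integrand is not integrable. -/
def action (e : Fin N → Plane) (L : Fin N → ℝ → ℝ) (s t : ℝ) (X : ℝ → Plane) : EReal :=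
  if IntervalIntegrable (fun τ => junctionLagrangian e L (X τ) (deriv X τ)) volume s t then
    ((∫ τ in s..t, junctionLagrangian e L (X τ) (deriv X τ) : ℝ) : EReal)
  else ⊤

open Classical in
/-- The minimal action `𝒟(s, y; t, x)`, for `s ≤ t`. -/
def minimalAction (e : Fin N → Plane) (L : Fin N → ℝ → ℝ) (s : ℝ) (y : Plane) (t : ℝ)
    (x : Plane) : EReal :=
  if s = t then (if y = x then 0 else ⊤)
  else ⨅ X ∈ trajectories e s y t x, action e L s t X

/-- The value function `u_oc` of the optimal control problem with initial datum `u₀`. -/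
def valueFunction (e : Fin N → Plane) (L : Fin N → ℝ → ℝ) (u₀ : Plane → ℝ) (t : ℝ)
    (x : Plane) : EReal :=
  ⨅ y ∈ junction e, ⨅ X ∈ trajectories e 0 y t x, ((u₀ y : ℝ) : EReal) + action e L 0 t X

end

end JunctionHJ

open JunctionHJ

/-! The proof is a comparison at a minimum. Reaching `x` at time `t` from `r` at time `τ` along a
branch costs `θ M((r - x) / θ)`, with `θ = t - τ` and `M v = Λ (-v)` as a function of the backward
velocity. Add this cost to `u`, together with penalties `η τ + κ / (t - τ)`. At a minimum point with
`τ > s` and `r > 0`, a constant minus the penalized cost is a test function touching `u` from below.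
The Legendre inequality `H(-M'(v)) ≤ v M'(v) - M(v)` then bounds the left side of the super-solution
inequality by `-η - κ / θ² < 0`, which is absurd (`not_min_on_branch`). So the minimum over a branch
lies at the initial time `s` or at the junction point.

For targets at the junction point, the minimum runs over all branches, and the test function must be
continuous across `0`. Hence all the functions `M i` need a common value at `0`, which is taken to
be the waiting cost `ℓ = min_k L_k(0)`. The device is `relaxed`: below a speed `v₀` the Lagrangian
cost is replaced by its tangent line at `v₀`, with `v₀` chosen so that this line takes the value `ℓ`
at velocity `0`. The same contradiction then excludes the junction point (`not_min_at_junction`),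
and only `τ = s` remains. The relaxed cost is still attained: approach at speed `v₀`, then wait.

The target time is first shifted to `t + ε`, with penalties vanishing as `ε → 0`. Lower
semicontinuity and superlinearity give the limit (`exists_of_frequently_approx`). For `x ≠ 0` the
minimum on the branch may be at `(τ, 0)`; the result at the junction point on `[s, τ]` then supplies
the rest of the trajectory. -/

namespace JunctionHJ

open Filter Topology

variable {N : ℕ} {e : Fin N → Plane}

/-! ### Geometry of the junction -/

theorem smul_mem_branch (i : Fin N) {r : ℝ} (hr : 0 ≤ r) : r • e i ∈ branch e i := ⟨r, hr, rfl⟩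

theorem smul_mem_junction (i : Fin N) {r : ℝ} (hr : 0 ≤ r) : r • e i ∈ junction e :=
  mem_iUnion.2 ⟨i, smul_mem_branch i hr⟩

theorem mem_junction_iff {x : Plane} : x ∈ junction e ↔ ∃ i, ∃ r : ℝ, 0 ≤ r ∧ x = r • e i := by
  simp [junction, branch]

theorem norm_smul_unit (he : ∀ i, ‖e i‖ = 1) (i : Fin N) {r : ℝ} (hr : 0 ≤ r) :
    ‖r • e i‖ = r := by
  rw [norm_smul, he, mul_one, Real.norm_of_nonneg hr]

/-- Distinct branches only meet at the origin. -/
theorem eq_of_smul_eq_smul (he : ∀ i, ‖e i‖ = 1) (he_inj : Function.Injective e) {i k : Fin N}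
    {r ρ : ℝ} (hr : 0 < r) (hρ : 0 ≤ ρ) (h : r • e i = ρ • e k) : i = k ∧ r = ρ := by
  have h1 : r = ρ := by
    have := congrArg norm h
    rwa [norm_smul_unit he i hr.le, norm_smul_unit he k hρ] at this
  subst h1
  exact ⟨he_inj (smul_right_injective _ hr.ne' h), rfl⟩

theorem geoDist_zero (he : ∀ i, ‖e i‖ = 1) (i : Fin N) {r : ℝ} (hr : 0 ≤ r) :
    geoDist e (r • e i) 0 = r := by
  unfold geoDist
  split_ifs <;> simp [norm_smul_unit he i hr]

theorem geoDist_smul_smul (he : ∀ i, ‖e i‖ = 1) (i : Fin N) {r ρ : ℝ} (hr : 0 ≤ r) (hρ : 0 ≤ ρ) :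
    geoDist e (r • e i) (ρ • e i) = |r - ρ| := by
  unfold geoDist
  rw [if_pos ⟨i, smul_mem_branch i hr, smul_mem_branch i hρ⟩, ← sub_smul, norm_smul, he, mul_one,
    Real.norm_eq_abs]

/-- Points close to a point of an open branch lie on that branch. -/
theorem eq_of_geoDist_lt (he : ∀ i, ‖e i‖ = 1) (he_inj : Function.Injective e) {i k : Fin N}
    {r ρ : ℝ} (hr : 0 < r) (hρ : 0 ≤ ρ) (h : geoDist e (ρ • e k) (r • e i) < r) :
    ρ • e k = ρ • e i := by
  unfold geoDist at h
  split_ifs at h with hc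
  · obtain ⟨m, ⟨a, ha, hka⟩, ⟨b, hb, hib⟩⟩ := hc
    obtain ⟨rfl, rfl⟩ := eq_of_smul_eq_smul he he_inj hr hb hib
    rcases hρ.eq_or_lt with rfl | hρ
    · simp
    · obtain ⟨rfl, rfl⟩ := eq_of_smul_eq_smul he he_inj hρ ha hka
      rfl
  · rw [norm_smul_unit he i hr.le, norm_smul_unit he k hρ] at h
    linarith

/-- Continuous functions on the plane which coordinatize the branches of the junction. -/
theorem exists_branch_coordinates (he : ∀ i, ‖e i‖ = 1) (he_inj : Function.Injective e) :
    ∃ π : Fin N → Plane → ℝ, ∀ i, Continuous (π i) ∧ (∀ r : ℝ, 0 ≤ r → π i (r • e i) = r) ∧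
      ∀ k, k ≠ i → ∀ r : ℝ, 0 ≤ r → π i (r • e k) = 0 := by
  have key : ∀ i : Fin N, ∃ c : ℝ, c < 1 ∧ ∀ k, k ≠ i → inner ℝ (e i) (e k) ≤ c := by
    intro i
    have h1 : ∀ k, ∀ᶠ c in 𝓝[<] (1 : ℝ), k ≠ i → inner ℝ (e i) (e k) ≤ c := by
      intro k
      by_cases hk : k = i
      · simp [hk]
      · have : inner ℝ (e i) (e k) < 1 :=
          (inner_lt_one_iff_real_of_norm_eq_one (he i) (he k)).2 fun h => hk (he_inj h).symm
        filter_upwards [mem_nhdsWithin_of_mem_nhds (Ioi_mem_nhds this)] with c hc _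
        exact le_of_lt hc
    obtain ⟨c, hc, hc1⟩ := ((eventually_all.2 h1).and self_mem_nhdsWithin).exists
    exact ⟨c, hc1, hc⟩
  choose c hc1 hc using key
  -- The numerator is `r (1 - c i)` at `r • e i`, and nonpositive on every other branch because `c
  -- i` bounds the inner products of `e i` with the other directions.
  refine ⟨fun i z => max 0 ((inner ℝ (e i) z - c i * ‖z‖) / (1 - c i)), fun i => ⟨?_, ?_, ?_⟩⟩
  · fun_prop
  · intro r hr
    have : (1 - c i) ≠ 0 := by linarith [hc1 i]
    beta_reduce
    rw [norm_smul_unit he i hr, inner_smul_right, real_inner_self_eq_norm_sq, he]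
    rw [show (r * 1 ^ 2 - c i * r) / (1 - c i) = r by field_simp]
    exact max_eq_right hr
  · intro k hk r hr
    beta_reduce
    rw [norm_smul_unit he k hr, inner_smul_right]
    apply max_eq_left
    apply div_nonpos_of_nonpos_of_nonneg _ (by linarith [hc1 i])
    nlinarith [hc i k hk]

/-! ### Test functions and the super-solution inequalities in coordinates -/

/-- A smooth map of the line into an interval which is the identity near a given point. -/
theorem exists_contDiff_mapsTo_Ioo {α β t₀ : ℝ} (ht : t₀ ∈ Ioo α β) :
    ∃ χ : ℝ → ℝ, ContDiff ℝ 1 χ ∧ (∀ τ, χ τ ∈ Ioo α β) ∧ ∀ᶠ τ in 𝓝 t₀, χ τ = τ := by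
  obtain ⟨d, hd, hd'⟩ : ∃ d : ℝ, 0 < d ∧ α < t₀ - d ∧ t₀ + d < β := by
    refine ⟨min (t₀ - α) (β - t₀) / 2, ?_, ?_, ?_⟩
    · have := lt_min (sub_pos.2 ht.1) (sub_pos.2 ht.2); linarith
    · have := min_le_left (t₀ - α) (β - t₀); linarith [ht.1]
    · have := min_le_right (t₀ - α) (β - t₀); linarith [ht.2]
  let b : ContDiffBump t₀ := ⟨d / 2, d, by linarith, by linarith⟩
  refine ⟨fun τ => t₀ + (τ - t₀) * b τ, ?_, ?_, ?_⟩
  · exact contDiff_const.add ((contDiff_id.sub contDiff_const).mul b.contDiff)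
  · intro τ
    have h0 : |(τ - t₀) * b τ| ≤ d := by
      rcases le_or_gt d (dist τ t₀) with h | h
      · rw [b.zero_of_le_dist h]; simpa using hd.le
      · rw [abs_mul, abs_of_nonneg b.nonneg]
        rw [Real.dist_eq] at h
        nlinarith [b.le_one (x := τ), b.nonneg (x := τ), abs_nonneg (τ - t₀)]
    have := abs_le.1 h0
    constructor <;> linarith
  · filter_upwards [b.eventuallyEq_one] with τ hτ
    simp [hτ]

/-- Test functions from their restrictions to the branches. -/
theorem exists_testFunction (he : ∀ i, ‖e i‖ = 1) (he_inj : Function.Injective e) (i₀ : Fin N)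
    (T : ℝ) {α β t₀ : ℝ} (ht : t₀ ∈ Ioo α β) (f : Fin N → ℝ → ℝ → ℝ)
    (hf : ∀ i, ContDiffOn ℝ 1 (Function.uncurry (f i)) (Ioo α β ×ˢ univ))
    (hf0 : ∀ i τ, f i τ 0 = f i₀ τ 0) :
    ∃ φ, IsTestFunction e T φ ∧ ∃ δ : ℝ, 0 < δ ∧ ∀ τ, |τ - t₀| < δ → ∀ i, ∀ r : ℝ, 0 ≤ r →
      φ τ (r • e i) = f i τ r := by
  obtain ⟨π, hπ⟩ := exists_branch_coordinates he he_inj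
  obtain ⟨χ, hχ, hχm, hχe⟩ := exists_contDiff_mapsTo_Ioo ht
  -- On each branch only one summand survives. The time cutoff `χ` is needed because `f` is smooth
  -- only for times in `(α, β)`, whereas a test function must be smooth on all of `(0, T)`.
  let φ : ℝ → Plane → ℝ := fun τ z =>
    f i₀ (χ τ) 0 + ∑ i, (f i (χ τ) (π i z) - f i (χ τ) 0)
  have hφ : ∀ τ i (r : ℝ), 0 ≤ r → φ τ (r • e i) = f i (χ τ) r := by
    intro τ i r hr
    simp only [φ]
    rw [Finset.sum_eq_single i]
    · rw [(hπ i).2.1 r hr, hf0 i]; ring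
    · intro k _ hk
      rw [(hπ k).2.2 i hk.symm r hr, sub_self]
    · simp
  have hcomp : ∀ i, ContDiff ℝ 1 (fun p : ℝ × ℝ => f i (χ p.1) p.2) := by
    intro i
    have h2 : ContDiff ℝ 1 (fun p : ℝ × ℝ => (χ p.1, p.2)) :=
      (hχ.comp contDiff_fst).prodMk contDiff_snd
    exact (hf i).comp_contDiff h2 fun p => ⟨hχm _, mem_univ _⟩
  refine ⟨φ, ⟨?_, ?_⟩, ?_⟩
  · have hc : ∀ i, Continuous (fun p : ℝ × ℝ => f i (χ p.1) p.2) := fun i => (hcomp i).continuous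
    apply Continuous.continuousOn
    have hz : ∀ i, Continuous (fun p : ℝ × Plane => f i (χ p.1) 0) := fun i =>
      (hc i).comp (continuous_fst.prodMk continuous_const)
    refine (hz i₀).add (continuous_finsetSum _ fun i _ => Continuous.sub ?_ (hz i))
    exact (hc i).comp (continuous_fst.prodMk ((hπ i).1.comp continuous_snd))
  · intro i
    refine (hcomp i).contDiffOn.congr ?_
    rintro ⟨τ, r⟩ ⟨_, hr⟩
    exact hφ τ i r hr
  · obtain ⟨δ, hδ, h⟩ := Metric.eventually_nhds_iff.1 hχe
    refine ⟨δ, hδ, fun τ hτ i r hr => ?_⟩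
    rw [hφ τ i r hr, h hτ]

theorem timeDeriv_eq {φ : ℝ → Plane → ℝ} {g : ℝ → ℝ} {t₀ a δ : ℝ} {x : Plane} (hδ : 0 < δ)
    (h : ∀ τ, |τ - t₀| < δ → φ τ x = g τ) (hg : HasDerivAt g a t₀) : timeDeriv φ t₀ x = a := by
  refine (hg.congr_of_eventuallyEq ?_).deriv
  exact Metric.eventually_nhds_iff.2 ⟨δ, hδ, fun τ hτ => h τ hτ⟩

theorem branchDeriv_eq {φ : ℝ → Plane → ℝ} {g : ℝ → ℝ} {i : Fin N} {t₀ r b : ℝ} (hr : 0 ≤ r)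
    (h : ∀ ρ, 0 ≤ ρ → φ t₀ (ρ • e i) = g ρ) (hg : HasDerivAt g b r) :
    branchDeriv e φ i t₀ r = b :=
  ((hg.hasDerivWithinAt (s := Ici 0)).congr h (h r hr)).derivWithin
    (uniqueDiffOn_Ici 0 r hr)

/-- The super-solution inequality on an open branch, in coordinates. -/
theorem IsSuperSolution.branch_ineq (he : ∀ i, ‖e i‖ = 1) (he_inj : Function.Injective e)
    {L : Fin N → ℝ → ℝ} {T : ℝ} {u : ℝ → Plane → ℝ} (hu : IsSuperSolution e L T u)
    {j : Fin N} {t₀ r₀ α β δ a b : ℝ} (ht : t₀ ∈ Ioo 0 T) (hr₀ : 0 < r₀) (htαβ : t₀ ∈ Ioo α β)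
    {f : ℝ → ℝ → ℝ} (hf : ContDiffOn ℝ 1 (Function.uncurry f) (Ioo α β ×ˢ univ))
    (heq : f t₀ r₀ = u t₀ (r₀ • e j)) (hδ : 0 < δ)
    (hle : ∀ τ r, |τ - t₀| < δ → 0 ≤ r → f τ r ≤ u τ (r • e j))
    (ha : HasDerivAt (fun τ => f τ r₀) a t₀) (hb : HasDerivAt (f t₀) b r₀) :
    0 ≤ a + hamiltonian L j b := by
  classical
  -- On the other branches the test function is extended by its value at the junction point. They do
  -- not matter for touching, since a ball of radius at most `r₀` sees only branch `j`.
  obtain ⟨φ, hφ, d, hd, hφf⟩ := exists_testFunction he he_inj j T htαβ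
    (fun i τ r => if i = j then f τ r else f τ 0) (by
      intro i
      by_cases hi : i = j
      · simpa [hi] using hf
      · simp only [hi, if_false]
        exact hf.comp (f := fun p : ℝ × ℝ => (p.1, (0 : ℝ))) (s := Ioo α β ×ˢ univ)
          (contDiff_fst.prodMk contDiff_const).contDiffOn fun p hp => ⟨hp.1, mem_univ _⟩)
    (by intro i τ; simp)
  have hφj : ∀ τ, |τ - t₀| < d → ∀ r : ℝ, 0 ≤ r → φ τ (r • e j) = f τ r := by
    intro τ hτ r hr
    simpa using hφf τ hτ j r hr
  have ht0 : |t₀ - t₀| < d := by simpa using hd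
  have := hu.on_branch φ hφ t₀ ht j r₀ hr₀ ⟨?_, min r₀ (min d δ), ?_, ?_⟩
  · rwa [timeDeriv_eq hd (fun τ hτ => hφj τ hτ r₀ hr₀.le) ha,
      branchDeriv_eq hr₀.le (fun r hr => hφj t₀ ht0 r hr) hb] at this
  · rw [hφj t₀ ht0 r₀ hr₀.le, heq]
  · exact lt_min hr₀ (lt_min hd hδ)
  · intro τ y hy hτ hd'
    obtain ⟨k, r, hr, rfl⟩ := mem_junction_iff.1 hy.2
    rw [lt_min_iff, lt_min_iff] at hτ
    rw [eq_of_geoDist_lt he he_inj hr₀ hr (lt_of_lt_of_le hd' (min_le_left _ _)),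
      hφj τ hτ.2.1 r hr]
    exact hle τ r hτ.2.2 hr

/-- The super-solution inequality at the junction point, in coordinates. -/
theorem IsSuperSolution.junction_ineq (he : ∀ i, ‖e i‖ = 1) (he_inj : Function.Injective e)
    (i₀ : Fin N)
    {L : Fin N → ℝ → ℝ} {T : ℝ} {u : ℝ → Plane → ℝ} (hu : IsSuperSolution e L T u)
    {t₀ α β δ a : ℝ} {b : Fin N → ℝ} (ht : t₀ ∈ Ioo 0 T) (htαβ : t₀ ∈ Ioo α β)
    {f : Fin N → ℝ → ℝ → ℝ}
    (hf : ∀ i, ContDiffOn ℝ 1 (Function.uncurry (f i)) (Ioo α β ×ˢ univ))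
    (hf0 : ∀ i τ, f i τ 0 = f i₀ τ 0)
    (heq : f i₀ t₀ 0 = u t₀ 0) (hδ : 0 < δ)
    (hle : ∀ i τ r, |τ - t₀| < δ → 0 ≤ r → f i τ r ≤ u τ (r • e i))
    (ha : HasDerivAt (fun τ => f i₀ τ 0) a t₀) (hb : ∀ i, HasDerivAt (f i t₀) (b i) 0) :
    0 ≤ a + junctionHamiltonian L b := by
  obtain ⟨φ, hφ, d, hd, hφf⟩ := exists_testFunction he he_inj i₀ T htαβ f hf hf0
  have ht0 : |t₀ - t₀| < d := by simpa using hd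
  have h0 : ∀ τ, |τ - t₀| < d → φ τ 0 = f i₀ τ 0 := fun τ hτ => by
    simpa using hφf τ hτ i₀ 0 le_rfl
  have := hu.at_junction φ hφ t₀ ht ⟨?_, min d δ, lt_min hd hδ, ?_⟩
  · rw [timeDeriv_eq hd h0 ha] at this
    have hb' : (fun i => branchDeriv e φ i t₀ 0) = b := funext fun i =>
      branchDeriv_eq le_rfl (fun r hr => hφf t₀ ht0 i r hr) (hb i)
    rwa [hb'] at this
  · rw [h0 t₀ ht0, heq]
  · intro τ y hy hτ _
    obtain ⟨k, r, hr, rfl⟩ := mem_junction_iff.1 hy.2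
    rw [lt_min_iff] at hτ
    rw [hφf τ hτ.1 k r hr]
    exact hle k τ r hτ.2 hr

/-! ### Tangent minorants and the penalized cost -/

/-- `M` is a `C¹` function of the backward velocity all of whose tangent lines lie below the
Lagrangian `Λ`. -/
structure IsTangentMinorant (Λ M M' : ℝ → ℝ) : Prop where
  hasDerivAt : ∀ v, HasDerivAt M (M' v) v
  continuous_deriv : Continuous M'
  tangent_le : ∀ v w, M v + M' v * (w - v) ≤ Λ (-w)

/-- Superlinearity of the perspective of `M`, for displacements from `x` to points `r ≥ 0`. -/
def IsCoerciveFrom (M : ℝ → ℝ) (x : ℝ) : Prop :=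
  ∀ A : ℝ, ∃ B : ℝ, ∀ r θ : ℝ, 0 ≤ r → 0 < θ → A * |r - x| - B * θ ≤ θ * M ((r - x) / θ)

/-- The cost of going from `r` at time `τ` to `x` at time `t`, with penalizations. -/
noncomputable def penalizedCost (M : ℝ → ℝ) (x t η κ τ r : ℝ) : ℝ :=
  (t - τ) * M ((r - x) / (t - τ)) + η * τ + κ / (t - τ)

theorem IsTangentMinorant.contDiff {Λ M M' : ℝ → ℝ} (h : IsTangentMinorant Λ M M') :
    ContDiff ℝ 1 M := by
  rw [contDiff_one_iff_deriv]
  refine ⟨fun v => (h.hasDerivAt v).differentiableAt, ?_⟩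
  rw [show deriv M = M' from funext fun v => (h.hasDerivAt v).deriv]
  exact h.continuous_deriv

theorem contDiffOn_penalizedCost {M : ℝ → ℝ} (hM : ContDiff ℝ 1 M) (x t η κ α : ℝ) :
    ContDiffOn ℝ 1 (Function.uncurry (penalizedCost M x t η κ)) (Ioo α t ×ˢ univ) := by
  have h1 : ContDiffOn ℝ 1 (fun p : ℝ × ℝ => t - p.1) (Ioo α t ×ˢ univ) :=
    (contDiff_const.sub contDiff_fst).contDiffOn
  have h0 : ∀ p ∈ Ioo α t ×ˢ (univ : Set ℝ), t - p.1 ≠ 0 := fun p hp =>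
    (sub_pos.2 hp.1.2).ne'
  have h2 : ContDiffOn ℝ 1 (fun p : ℝ × ℝ => (p.2 - x) / (t - p.1)) (Ioo α t ×ˢ univ) :=
    (contDiff_snd.sub contDiff_const).contDiffOn.div h1 h0
  exact ((h1.mul (hM.comp_contDiffOn h2)).add
    (contDiff_const.mul contDiff_fst).contDiffOn).add (contDiffOn_const.div h1 h0)

theorem continuousOn_penalizedCost {M : ℝ → ℝ} (hM : Continuous M) (x t η κ : ℝ) :
    ContinuousOn (Function.uncurry (penalizedCost M x t η κ)) (Iio t ×ˢ univ) := by
  have h1 : ContinuousOn (fun p : ℝ × ℝ => t - p.1) (Iio t ×ˢ univ) :=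
    (continuous_const.sub continuous_fst).continuousOn
  have h0 : ∀ p ∈ Iio t ×ˢ (univ : Set ℝ), t - p.1 ≠ 0 := fun p hp =>
    (sub_pos.2 hp.1).ne'
  have h2 : ContinuousOn (fun p : ℝ × ℝ => (p.2 - x) / (t - p.1)) (Iio t ×ˢ univ) :=
    (continuous_snd.sub continuous_const).continuousOn.div h1 h0
  exact ((h1.mul (hM.comp_continuousOn h2)).add
    (continuous_const.mul continuous_fst).continuousOn).add (continuousOn_const.div h1 h0)

theorem hasDerivAt_penalizedCost_time {M : ℝ → ℝ} {x t η κ τ r m : ℝ} (hτ : τ < t)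
    (hM : HasDerivAt M m ((r - x) / (t - τ))) :
    HasDerivAt (fun τ => penalizedCost M x t η κ τ r)
      (-M ((r - x) / (t - τ)) + (r - x) / (t - τ) * m + η + κ / (t - τ) ^ 2) τ := by
  have h0 : t - τ ≠ 0 := (sub_pos.2 hτ).ne'
  have h1 : HasDerivAt (fun τ => t - τ) (-1) τ := by
    simpa using (hasDerivAt_id τ).const_sub t
  have h2 : HasDerivAt (fun τ => (r - x) / (t - τ)) ((r - x) / (t - τ) ^ 2) τ := by
    refine ((hasDerivAt_const τ (r - x)).fun_div h1 h0).congr_deriv ?_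
    ring
  have h3 : HasDerivAt (fun τ => κ / (t - τ)) (κ / (t - τ) ^ 2) τ := by
    refine ((hasDerivAt_const τ κ).fun_div h1 h0).congr_deriv ?_
    ring
  have h4 := hM.comp τ h2
  refine (((h1.mul h4).add ((hasDerivAt_id τ).const_mul η)).add h3).congr_deriv ?_
  simp only [Function.comp_apply]
  field_simp

theorem hasDerivAt_penalizedCost_space {M : ℝ → ℝ} {x t η κ τ r m : ℝ} (hτ : τ < t)
    (hM : HasDerivAt M m ((r - x) / (t - τ))) :
    HasDerivAt (penalizedCost M x t η κ τ) m r := by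
  have h0 : t - τ ≠ 0 := (sub_pos.2 hτ).ne'
  have h1 : HasDerivAt (fun r => (r - x) / (t - τ)) (1 / (t - τ)) r :=
    ((hasDerivAt_id r).sub_const x).div_const _
  have h2 : HasDerivAt (fun r => (t - τ) * M ((r - x) / (t - τ)))
    ((t - τ) * (m * (1 / (t - τ)))) r := (hM.comp r h1).const_mul (t - τ)
  refine ((h2.add_const (η * τ)).add_const (κ / (t - τ))).congr_deriv ?_
  field_simp

/-! ### Existence of minimizers -/

theorem IsSuperSolution.lowerSemicontinuousOn_branch {L : Fin N → ℝ → ℝ} {T : ℝ}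
    {u : ℝ → Plane → ℝ} (hu : IsSuperSolution e L T u) (i : Fin N) :
    LowerSemicontinuousOn (fun p : ℝ × ℝ => u p.1 (p.2 • e i)) (Ico 0 T ×ˢ Ici 0) := by
  have hc : Continuous fun p : ℝ × ℝ => (p.1, p.2 • e i) := by fun_prop
  exact hu.lowerSemicontinuousOn.comp hc.continuousOn fun p hp =>
    ⟨hp.1, smul_mem_junction i hp.2⟩

/-- A coercive lower semicontinuous function on a half-open strip attains its minimum. -/
theorem exists_isMinOn_strip {G : ℝ × ℝ → ℝ} {s t κ C : ℝ} (hst : s < t) (hκ : 0 < κ)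
    (hG : LowerSemicontinuousOn G (Ico s t ×ˢ Ici 0))
    (hlow : ∀ τ ∈ Ico s t, ∀ r : ℝ, 0 ≤ r → r + κ / (t - τ) - C ≤ G (τ, r)) :
    ∃ p ∈ Ico s t ×ˢ Ici (0 : ℝ), ∀ q ∈ Ico s t ×ˢ Ici (0 : ℝ), G p ≤ G q := by
  -- Outside the compact set `K` below, either `r > g` or `κ / (t - τ) > g`, so that `G` exceeds its
  -- value at `(s, 0)`.
  set g := |G (s, 0) + C| + 1 with hg
  have hgpos : 0 < g := by positivity
  have hd : 0 < κ / g := by positivity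
  set K : Set (ℝ × ℝ) := Icc s (max s (t - κ / g)) ×ˢ Icc 0 g with hK
  have hsub : K ⊆ Ico s t ×ˢ Ici (0 : ℝ) := by
    rintro ⟨τ, r⟩ ⟨h1, h2⟩
    refine ⟨⟨h1.1, h1.2.trans_lt (max_lt hst (by linarith))⟩, h2.1⟩
  have hs0 : (s, (0 : ℝ)) ∈ K := ⟨⟨le_rfl, le_max_left _ _⟩, ⟨le_rfl, hgpos.le⟩⟩
  obtain ⟨p, hp, hmin⟩ := (hG.mono hsub).exists_isMinOn ⟨_, hs0⟩ (isCompact_Icc.prod isCompact_Icc)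
  refine ⟨p, hsub hp, ?_⟩
  rintro ⟨τ, r⟩ hq
  by_cases hqK : (τ, r) ∈ K
  · exact hmin hqK
  · have h0 : G p ≤ G (s, 0) := hmin hs0
    have h1 := hlow τ hq.1 r hq.2
    refine h0.trans (le_of_not_gt fun hlt => hqK ?_)
    have hpos : 0 < t - τ := sub_pos.2 hq.1.2
    have h2 : G (s, 0) + C < g := by rw [hg]; linarith [le_abs_self (G (s, 0) + C)]
    have h3 : 0 < κ / (t - τ) := by positivity
    have hr : 0 ≤ r := hq.2
    refine ⟨⟨hq.1.1, le_max_of_le_right ?_⟩, hr, by linarith⟩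
    have h4 : κ / (t - τ) ≤ g := by linarith
    rw [div_le_iff₀ hpos] at h4
    have : κ / g ≤ t - τ := by rw [div_le_iff₀ hgpos]; linarith
    linarith

theorem exists_min_penalized {L : Fin N → ℝ → ℝ} {T : ℝ} {u : ℝ → Plane → ℝ}
    (hu : IsSuperSolution e L T u) {s t C x η κ : ℝ} (hs : 0 ≤ s) (hst : s < t) (htT : t ≤ T)
    (hC : 0 ≤ C) (i : Fin N)
    (hlow : ∀ τ ∈ Ico s T, ∀ r : ℝ, 0 ≤ r → -C * (1 + r) ≤ u τ (r • e i))
    {M : ℝ → ℝ} (hM : Continuous M) (hco : IsCoerciveFrom M x) (hη : 0 ≤ η) (hκ : 0 < κ) :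
    ∃ τ r, τ ∈ Ico s t ∧ 0 ≤ r ∧ ∀ τ' ∈ Ico s t, ∀ r' : ℝ, 0 ≤ r' →
      u τ (r • e i) + penalizedCost M x t η κ τ r ≤
        u τ' (r' • e i) + penalizedCost M x t η κ τ' r' := by
  -- Slope `C + 1` absorbs the linear decay `-C (1 + r)` of `u` and leaves growth `r`.
  obtain ⟨B, hB⟩ := hco (C + 1)
  have hG : LowerSemicontinuousOn
      (fun p : ℝ × ℝ => u p.1 (p.2 • e i) + penalizedCost M x t η κ p.1 p.2)
      (Ico s t ×ˢ Ici 0) := by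
    refine LowerSemicontinuousOn.add ((hu.lowerSemicontinuousOn_branch i).mono ?_)
      (ContinuousOn.lowerSemicontinuousOn ((continuousOn_penalizedCost hM x t η κ).mono ?_))
    · exact prod_mono (Ico_subset_Ico hs htT) Subset.rfl
    · exact prod_mono (fun τ hτ => hτ.2) (subset_univ _)
  obtain ⟨⟨τ, r⟩, hp, hmin⟩ := exists_isMinOn_strip (C := C + (C + 1) * |x| + |B| * (t - s))
    hst hκ hG (by
      intro τ hτ r hr
      have h1 := hlow τ ⟨hτ.1, hτ.2.trans_le htT⟩ r hr
      have hpos : 0 < t - τ := sub_pos.2 hτ.2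
      have h2 := hB r (t - τ) hr hpos
      have h3 : r - |x| ≤ |r - x| := by linarith [le_abs_self (r - x), le_abs_self x]
      have h4 : B * (t - τ) ≤ |B| * (t - s) :=
        mul_le_mul (le_abs_self B) (by linarith [hτ.1]) hpos.le (abs_nonneg B)
      have h5 : 0 ≤ η * τ := mul_nonneg hη (hs.trans hτ.1)
      simp only [penalizedCost]
      nlinarith)
  exact ⟨τ, r, hp.1, hp.2, fun τ' hτ' r' hr' => hmin (τ', r') ⟨hτ', hr'⟩⟩

/-! ### Exclusion of minima at later times -/

/-- The tangent line at `v`, evaluated at `w = -q`, bounds each term of the supremum. Only this half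
of Legendre duality is needed, which is why `M` may be any tangent minorant. -/
theorem hamiltonian_le_of_tangent {L : Fin N → ℝ → ℝ} {i : Fin N} {M M' : ℝ → ℝ}
    (hM : IsTangentMinorant (L i) M M') (v : ℝ) : hamiltonian L i (-M' v) ≤ v * M' v - M v := by
  refine ciSup_le fun q => ?_
  have := hM.tangent_le v (-q)
  rw [neg_neg] at this
  linarith

theorem hamiltonianMinus_le_of_tangent {L : Fin N → ℝ → ℝ} {i : Fin N} {M M' : ℝ → ℝ}
    (hM : IsTangentMinorant (L i) M M') (v : ℝ) :
    hamiltonianMinus L i (-M' v) ≤ v * M' v - M v := by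
  have : Nonempty (Iic (0 : ℝ)) := ⟨⟨0, mem_Iic.2 le_rfl⟩⟩
  refine ciSup_le fun q => ?_
  have := hM.tangent_le v (-(q : ℝ))
  rw [neg_neg] at this
  linarith

/-- The minimum of a penalized super-solution cannot be attained inside an open branch. -/
theorem not_min_on_branch (he : ∀ i, ‖e i‖ = 1) (he_inj : Function.Injective e)
    {L : Fin N → ℝ → ℝ} {T : ℝ} {u : ℝ → Plane → ℝ} (hu : IsSuperSolution e L T u)
    {s t x η κ : ℝ} (hs : 0 ≤ s) (htT : t ≤ T) {j : Fin N} {M M' : ℝ → ℝ}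
    (hM : IsTangentMinorant (L j) M M') (hη : 0 < η) (hκ : 0 < κ) {τ r : ℝ} (hτ : τ ∈ Ioo s t)
    (hr : 0 < r) (hmin : ∀ τ' ∈ Ico s t, ∀ r' : ℝ, 0 ≤ r' →
      u τ (r • e j) + penalizedCost M x t η κ τ r ≤
        u τ' (r' • e j) + penalizedCost M x t η κ τ' r') : False := by
  have hpos : 0 < t - τ := sub_pos.2 hτ.2
  set c := u τ (r • e j) + penalizedCost M x t η κ τ r with hc
  have hd := hM.hasDerivAt ((r - x) / (t - τ))
  -- The test function is `c` minus the penalized cost, which touches `u` from below because the sum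
  -- is minimal at `(τ, r)`.
  have := hu.branch_ineq he he_inj (δ := min (τ - s) (t - τ)) (j := j)
    (f := fun τ' r' => c - penalizedCost M x t η κ τ' r')
    ⟨hs.trans_lt hτ.1, hτ.2.trans_le htT⟩ hr hτ
    (contDiffOn_const.sub (contDiffOn_penalizedCost hM.contDiff x t η κ s)) (by rw [hc]; ring)
    (lt_min (sub_pos.2 hτ.1) hpos) (by
      intro τ' r' h1 h2
      rw [lt_min_iff, abs_lt, abs_lt] at h1
      have := hmin τ' ⟨by linarith, by linarith⟩ r' h2
      linarith)
    ((hasDerivAt_penalizedCost_time hτ.2 hd).const_sub c)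
    ((hasDerivAt_penalizedCost_space hτ.2 hd).const_sub c)
  have h2 := hamiltonian_le_of_tangent hM ((r - x) / (t - τ))
  have h3 : 0 < κ / (t - τ) ^ 2 := by positivity
  linarith

/-- The minimum of a penalized super-solution cannot be attained at the junction point. -/
theorem not_min_at_junction (he : ∀ i, ‖e i‖ = 1) (he_inj : Function.Injective e) (i₀ : Fin N)
    {L : Fin N → ℝ → ℝ} {T : ℝ} {u : ℝ → Plane → ℝ} (hu : IsSuperSolution e L T u)
    {s t η κ : ℝ} (hs : 0 ≤ s) (htT : t ≤ T) {M M' : Fin N → ℝ → ℝ}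
    (hM : ∀ i, IsTangentMinorant (L i) (M i) (M' i)) (hM0 : ∀ i, M i 0 = M i₀ 0)
    (hη : 0 < η) (hκ : 0 < κ) {τ : ℝ} (hτ : τ ∈ Ioo s t)
    (hmin : ∀ τ' ∈ Ico s t, ∀ i, ∀ r' : ℝ, 0 ≤ r' →
      u τ 0 + penalizedCost (M i₀) 0 t η κ τ 0 ≤
        u τ' (r' • e i) + penalizedCost (M i) 0 t η κ τ' r') : False := by
  have hpos : 0 < t - τ := sub_pos.2 hτ.2
  set c := u τ 0 + penalizedCost (M i₀) 0 t η κ τ 0 with hc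
  have hd := fun i => (hM i).hasDerivAt ((0 - 0) / (t - τ))
  have := hu.junction_ineq he he_inj i₀ (δ := min (τ - s) (t - τ))
    (f := fun i τ' r' => c - penalizedCost (M i) 0 t η κ τ' r')
    ⟨hs.trans_lt hτ.1, hτ.2.trans_le htT⟩ hτ
    (fun i => contDiffOn_const.sub (contDiffOn_penalizedCost (hM i).contDiff 0 t η κ s))
    (by intro i τ'; simp [penalizedCost, hM0 i]) (by rw [hc]; ring)
    (lt_min (sub_pos.2 hτ.1) hpos) (by
      intro i τ' r' h1 h2
      rw [lt_min_iff, abs_lt, abs_lt] at h1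
      have := hmin τ' ⟨by linarith, by linarith⟩ i r' h2
      linarith)
    ((hasDerivAt_penalizedCost_time hτ.2 (hd i₀)).const_sub c)
    (fun i => (hasDerivAt_penalizedCost_space hτ.2 (hd i)).const_sub c)
  -- At the junction point the velocity is `0`, so the term `v M'(v)` drops out and each branch
  -- contributes the same bound, by the common value of `M i` at `0`.
  have h2 : junctionHamiltonian L (fun i => -M' i ((0 - 0) / (t - τ))) ≤ -M i₀ 0 := by
    have : Nonempty (Fin N) := ⟨i₀⟩
    refine ciSup_le fun i => ?_
    have := hamiltonianMinus_le_of_tangent (hM i) ((0 - 0) / (t - τ))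
    simpa [hM0 i] using this
  have h3 : 0 < κ / (t - τ) ^ 2 := by positivity
  simp only [sub_zero, zero_div, zero_mul] at this h2
  linarith

/-! ### Approximate super-optimality and passage to the limit -/

theorem cost_le_penalizedCost {M : ℝ → ℝ} {x t η κ τ r : ℝ} (hη : 0 ≤ η) (hκ : 0 ≤ κ)
    (hτ0 : 0 ≤ τ) (hτ : τ < t) :
    (t - τ) * M ((r - x) / (t - τ)) ≤ penalizedCost M x t η κ τ r := by
  have h1 : 0 ≤ η * τ := mul_nonneg hη hτ0
  have h2 : 0 ≤ κ / (t - τ) := div_nonneg hκ (sub_pos.2 hτ).le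
  rw [penalizedCost]
  linarith

/-- With the target time shifted by `ε`, the choice `κ = ε²` makes the singular penalty equal to `ε`
at time `t`, so the whole cost of the competitor `(t, x)` is of order `ε`. -/
theorem penalizedCost_self (M : ℝ → ℝ) (x t : ℝ) {ε : ℝ} (hε : 0 < ε) :
    penalizedCost M x (t + ε) ε (ε ^ 2) t x = ε * (M 0 + t + 1) := by
  rw [penalizedCost, add_sub_cancel_left, sub_self, zero_div]
  field_simp

/-- Approximate super-optimality along a branch, up to the junction point. -/
theorem exists_approx_branch (he : ∀ i, ‖e i‖ = 1) (he_inj : Function.Injective e)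
    {L : Fin N → ℝ → ℝ} {T : ℝ} {u : ℝ → Plane → ℝ} (hu : IsSuperSolution e L T u)
    {s t x C ε : ℝ} (hs : 0 ≤ s) (hst : s < t) (hC : 0 ≤ C) (j : Fin N)
    (hlow : ∀ τ ∈ Ico s T, ∀ r : ℝ, 0 ≤ r → -C * (1 + r) ≤ u τ (r • e j))
    {M M' : ℝ → ℝ} (hM : IsTangentMinorant (L j) M M') (hco : IsCoerciveFrom M x) (hx : 0 ≤ x)
    (hε : 0 < ε) (hεT : t + ε < T) :
    ∃ τ r, τ ∈ Ico s (t + ε) ∧ 0 ≤ r ∧ (τ = s ∨ r = 0) ∧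
      u τ (r • e j) + (t + ε - τ) * M ((r - x) / (t + ε - τ)) ≤
        u t (x • e j) + ε * (M 0 + t + 1) := by
  obtain ⟨τ, r, hτ, hr, hmin⟩ := exists_min_penalized hu hs (show s < t + ε by linarith) hεT.le hC
    j hlow hM.contDiff.continuous hco hε.le (pow_pos hε 2)
  refine ⟨τ, r, hτ, hr, ?_, ?_⟩
  · by_contra! hcon
    exact not_min_on_branch he he_inj hu hs hεT.le hM hε (pow_pos hε 2)
      ⟨lt_of_le_of_ne hτ.1 hcon.1.symm, hτ.2⟩ (lt_of_le_of_ne hr hcon.2.symm) hmin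
  · have h1 := hmin t ⟨hst.le, by linarith⟩ x hx
    rw [penalizedCost_self M x t hε] at h1
    have := cost_le_penalizedCost (M := M) (x := x) (r := r) hε.le (sq_nonneg ε) (hs.trans hτ.1) hτ.2
    linarith

/-- Approximate super-optimality from the junction point. -/
theorem exists_approx_junction (he : ∀ i, ‖e i‖ = 1) (he_inj : Function.Injective e) (i₀ : Fin N)
    {L : Fin N → ℝ → ℝ} {T : ℝ} {u : ℝ → Plane → ℝ} (hu : IsSuperSolution e L T u)
    {s t C ε : ℝ} (hs : 0 ≤ s) (hst : s < t) (hC : 0 ≤ C)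
    (hlow : ∀ τ ∈ Ico s T, ∀ i, ∀ r : ℝ, 0 ≤ r → -C * (1 + r) ≤ u τ (r • e i))
    {M M' : Fin N → ℝ → ℝ} (hM : ∀ i, IsTangentMinorant (L i) (M i) (M' i))
    (hco : ∀ i, IsCoerciveFrom (M i) 0) (hM0 : ∀ i, M i 0 = M i₀ 0)
    (hε : 0 < ε) (hεT : t + ε < T) :
    ∃ i r, 0 ≤ r ∧ u s (r • e i) + (t + ε - s) * M i ((r - 0) / (t + ε - s)) ≤
        u t 0 + ε * (M i₀ 0 + t + 1) := by
  have hst' : s < t + ε := by linarith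
  choose τ r hτ hr hmin using fun i => exists_min_penalized hu hs hst' hεT.le hC
    i (fun τ hτ => hlow τ hτ i) (hM i).contDiff.continuous (hco i) hε.le (pow_pos hε 2)
  have : Nonempty (Fin N) := ⟨i₀⟩
  obtain ⟨i, hi⟩ := Finite.exists_min fun i =>
    u (τ i) (r i • e i) + penalizedCost (M i) 0 (t + ε) ε (ε ^ 2) (τ i) (r i)
  have hmin' : ∀ τ' ∈ Ico s (t + ε), ∀ k, ∀ r' : ℝ, 0 ≤ r' →
      u (τ i) (r i • e i) + penalizedCost (M i) 0 (t + ε) ε (ε ^ 2) (τ i) (r i) ≤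
        u τ' (r' • e k) + penalizedCost (M k) 0 (t + ε) ε (ε ^ 2) τ' r' :=
    fun τ' hτ' k r' hr' => (hi k).trans (hmin k τ' hτ' r' hr')
  -- The best of the branchwise minima is a minimum over the whole junction, so both exclusion
  -- results apply to it.
  have hτs : τ i = s := by
    by_contra hcon
    have hτ' : τ i ∈ Ioo s (t + ε) := ⟨lt_of_le_of_ne (hτ i).1 (Ne.symm hcon), (hτ i).2⟩
    rcases (hr i).eq_or_lt with h0 | h0
    · refine not_min_at_junction he he_inj i hu hs hεT.le hM
        (fun k => (hM0 k).trans (hM0 i).symm) hε (pow_pos hε 2) hτ' ?_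
      simpa [← h0] using hmin'
    · exact not_min_on_branch he he_inj hu hs hεT.le (hM i) hε (pow_pos hε 2) hτ' h0 (hmin i)
  refine ⟨i, r i, hr i, ?_⟩
  have h1 := hmin' t ⟨hst.le, by linarith⟩ i 0 le_rfl
  rw [penalizedCost_self _ 0 t hε, zero_smul, hM0 i, hτs] at h1
  have := cost_le_penalizedCost (M := M i) (x := 0) (r := r i) hε.le (sq_nonneg ε) hs hst'
  linarith

/-- Passage to the limit in approximate super-optimality along a branch. -/
theorem exists_of_frequently_approx {L : Fin N → ℝ → ℝ} {T : ℝ} {u : ℝ → Plane → ℝ}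
    (hu : IsSuperSolution e L T u) {s t x C U K : ℝ} (hs : 0 ≤ s) (htT : t < T) (hC : 0 ≤ C)
    (i : Fin N) (hlow : ∀ τ ∈ Ico s T, ∀ r : ℝ, 0 ≤ r → -C * (1 + r) ≤ u τ (r • e i))
    {M : ℝ → ℝ} (hM : Continuous M) (hco : IsCoerciveFrom M x) {S : Set (ℝ × ℝ)}
    (hS : IsClosed S) (hxS : (t, x) ∉ S) {ε : ℕ → ℝ} (hε : Tendsto ε atTop (𝓝 0))
    (happ : ∃ᶠ n in atTop, ∃ τ r, τ ∈ Ico s (t + ε n) ∧ 0 ≤ r ∧ (τ, r) ∈ S ∧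
      u τ (r • e i) + (t + ε n - τ) * M ((r - x) / (t + ε n - τ)) ≤ U + ε n * K) :
    ∃ τ r, τ ∈ Ico s t ∧ 0 ≤ r ∧ (τ, r) ∈ S ∧
      u τ (r • e i) + (t - τ) * M ((r - x) / (t - τ)) ≤ U := by
  have hev : ∀ᶠ n in atTop, t + ε n < T ∧ |ε n * K| < 1 := by
    refine (Tendsto.eventually_lt_const (u := T) (v := t + 0) (by simpa using htT)
      (hε.const_add t)).and ?_
    have h : Tendsto (fun n => |ε n * K|) atTop (𝓝 0) := by
      simpa using (hε.mul_const K).abs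
    exact h.eventually_lt_const one_pos
  obtain ⟨φ, hφ, hφ'⟩ := extraction_of_frequently_atTop (happ.and_eventually hev)
  choose hA hεT hεK using hφ'
  choose τ r hτ hr hrS hle using hA
  obtain ⟨B, hB⟩ := hco (C + 1)
  have hbound : ∀ n, (τ n, r n) ∈ Icc s T ×ˢ Icc 0 (U + 1 + C + (C + 1) * |x| + |B| * (T - s)) := by
    intro n
    have hT' : t + ε (φ n) < T := hεT n
    refine ⟨⟨(hτ n).1, ((hτ n).2.trans hT').le⟩, hr n, ?_⟩
    have h1 := hlow (τ n) ⟨(hτ n).1, (hτ n).2.trans hT'⟩ (r n) (hr n)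
    have hpos : 0 < t + ε (φ n) - τ n := sub_pos.2 (hτ n).2
    have h2 := hB (r n) _ (hr n) hpos
    have h3 : r n - |x| ≤ |r n - x| := by linarith [le_abs_self (r n - x), le_abs_self x]
    have h4 : B * (t + ε (φ n) - τ n) ≤ |B| * (T - s) :=
      mul_le_mul (le_abs_self B) (by linarith [(hτ n).1]) hpos.le (abs_nonneg B)
    have h5 := le_of_abs_le (hεK n).le
    have h6 := hle n
    nlinarith
  obtain ⟨⟨τ₀, r₀⟩, ⟨hτ₀, hr₀⟩, ψ, hψ, hlim⟩ :=
    (isCompact_Icc.prod isCompact_Icc).tendsto_subseq hbound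
  have hε' : Tendsto (fun n => ε (φ (ψ n))) atTop (𝓝 0) :=
    hε.comp (hφ.tendsto_atTop.comp hψ.tendsto_atTop)
  have hτlim : Tendsto (fun n => τ (ψ n)) atTop (𝓝 τ₀) := (continuous_fst.tendsto _).comp hlim
  have hrlim : Tendsto (fun n => r (ψ n)) atTop (𝓝 r₀) := (continuous_snd.tendsto _).comp hlim
  have hr₀0 : 0 ≤ r₀ := hr₀.1
  have hS₀ : (τ₀, r₀) ∈ S := hS.mem_of_tendsto hlim (Eventually.of_forall fun n => hrS (ψ n))
  have hθ : Tendsto (fun n => t + ε (φ (ψ n)) - τ (ψ n)) atTop (𝓝 (t - τ₀)) := by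
    simpa using (hε'.const_add t).sub hτlim
  have hτt : τ₀ ≤ t := by
    have : 0 ≤ t - τ₀ := ge_of_tendsto hθ (Eventually.of_forall fun n => (sub_pos.2 (hτ _).2).le)
    linarith
  have hUlim : Tendsto (fun n => U + ε (φ (ψ n)) * K) atTop (𝓝 U) := by
    simpa using (hε'.mul_const K).const_add U
  rcases hτt.eq_or_lt with rfl | hlt
  · exfalso
    have hd : 0 < |r₀ - x| := by
      rw [abs_pos, sub_ne_zero]
      rintro rfl
      exact hxS hS₀
    -- If the times converge to `t`, a distance `|r₀ - x| > 0` is covered in vanishing time. This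
    -- slope makes the limiting lower bound equal to `U + 1`, which contradicts the upper bound `U`.
    set A := (U + C * (1 + r₀) + 1) / |r₀ - x| with hAdef
    obtain ⟨B, hB⟩ := hco A
    have h1 : Tendsto (fun n => -C * (1 + r (ψ n)) + (A * |r (ψ n) - x| -
        B * (τ₀ + ε (φ (ψ n)) - τ (ψ n)))) atTop
        (𝓝 (-C * (1 + r₀) + (A * |r₀ - x| - B * (τ₀ - τ₀)))) :=
      ((hrlim.const_add 1).const_mul (-C)).add
        (((hrlim.sub_const x).abs.const_mul A).sub (hθ.const_mul B))
    have h2 := le_of_tendsto_of_tendsto' h1 hUlim fun n => by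
      have h3 := hlow (τ (ψ n)) ⟨(hτ _).1, (hτ _).2.trans (hεT _)⟩ (r (ψ n)) (hr _)
      have h4 := hB (r (ψ n)) _ (hr _) (sub_pos.2 (hτ (ψ n)).2)
      have h5 := hle (ψ n)
      linarith
    have h6 : A * |r₀ - x| = U + C * (1 + r₀) + 1 := by
      rw [hAdef]; field_simp
    rw [h6, sub_self] at h2
    linarith
  · refine ⟨τ₀, r₀, ⟨hτ₀.1, hlt⟩, hr₀0, hS₀, ?_⟩
    have hne : t - τ₀ ≠ 0 := (sub_pos.2 hlt).ne'
    have hcost : Tendsto (fun n => U + ε (φ (ψ n)) * K - (t + ε (φ (ψ n)) - τ (ψ n)) *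
        M ((r (ψ n) - x) / (t + ε (φ (ψ n)) - τ (ψ n)))) atTop
        (𝓝 (U - (t - τ₀) * M ((r₀ - x) / (t - τ₀)))) :=
      hUlim.sub (hθ.mul ((hM.tendsto _).comp ((hrlim.sub_const x).div hθ hne)))
    by_contra! hcon
    -- Lower semicontinuity keeps `u` above `y` along the sequence, while its upper bounds converge
    -- to a value below `y`.
    obtain ⟨y, hy1, hy2⟩ := exists_between (sub_lt_iff_lt_add.2 hcon)
    have hlsc := hu.lowerSemicontinuousOn_branch i (τ₀, r₀)
      ⟨⟨hs.trans hτ₀.1, hlt.trans htT⟩, hr₀0⟩ y hy2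
    have hin : Tendsto (fun n => (τ (ψ n), r (ψ n))) atTop
        (𝓝[Ico 0 T ×ˢ Ici 0] (τ₀, r₀)) :=
      tendsto_nhdsWithin_iff.2 ⟨hlim, Eventually.of_forall fun n =>
        ⟨⟨hs.trans (hτ _).1, (hτ _).2.trans (hεT _)⟩, hr _⟩⟩
    have hfin := ge_of_tendsto hcost ((hin.eventually hlsc).mono fun n hn => by
      have h1 := hle (ψ n)
      have h2 : y < u (τ (ψ n)) (r (ψ n) • e i) := hn
      show y ≤ _
      linarith)
    linarith

/-! ### Uniform convexity and the relaxed cost -/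

/-- A uniformly convex `C¹` function lies above its tangent lines, with a quadratic gap. -/
theorem tangent_add_sq_le {f f' : ℝ → ℝ} {γ : ℝ} (hf : ∀ q, HasDerivAt f (f' q) q)
    (hmono : Monotone fun q => f' q - γ * q) (p q : ℝ) :
    f p + f' p * (q - p) + γ / 2 * (q - p) ^ 2 ≤ f q := by
  have hg : ∀ q, HasDerivAt (fun q => f q - γ / 2 * q ^ 2) (f' q - γ * q) q := fun q =>
    ((hf q).sub (((hasDerivAt_id q).pow 2).const_mul (γ / 2))).congr_deriv (by simp; ring)
  have hconv : ConvexOn ℝ univ (fun q => f q - γ / 2 * q ^ 2) := by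
    refine Monotone.convexOn_univ_of_deriv (fun q => (hg q).differentiableAt) ?_
    rwa [show deriv (fun q => f q - γ / 2 * q ^ 2) = fun q => f' q - γ * q from
      funext fun q => (hg q).deriv]
  have key : f p - γ / 2 * p ^ 2 + (f' p - γ * p) * (q - p) ≤ f q - γ / 2 * q ^ 2 := by
    rcases lt_trichotomy p q with h | rfl | h
    · have := hconv.le_slope_of_hasDerivAt (mem_univ _) (mem_univ _) h (hg p)
      rw [slope_def_field, le_div_iff₀ (sub_pos.2 h)] at this
      linarith
    · simp
    · have := hconv.slope_le_of_hasDerivAt (mem_univ _) (mem_univ _) h (hg p)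
      rw [slope_def_field, div_le_iff₀ (sub_pos.2 h)] at this
      linarith
  nlinarith

/-- The derivative and the quadratic tangent inequality for uniformly convex Lagrangians. -/
theorem UniformlyConvexLagrangians.exists_deriv {L : Fin N → ℝ → ℝ}
    (hL : UniformlyConvexLagrangians L) : ∃ γ : ℝ, 0 < γ ∧ ∃ L' : Fin N → ℝ → ℝ, ∀ i,
      Continuous (L' i) ∧ (∀ q, HasDerivAt (L i) (L' i q) q) ∧
      ∀ p q, L i p + L' i p * (q - p) + γ / 2 * (q - p) ^ 2 ≤ L i q := by
  obtain ⟨γ, hγ, h⟩ := hL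
  refine ⟨γ, hγ, fun i => deriv (L i), fun i => ?_⟩
  have hC := (h i).1
  have hd : ∀ q, HasDerivAt (L i) (deriv (L i) q) q := fun q =>
    (hC.differentiable (by norm_num) q).hasDerivAt
  have hC1 : ContDiff ℝ 1 (deriv (L i)) := by
    have : ContDiff ℝ (1 + 1) (L i) := by norm_num; exact hC
    exact (contDiff_succ_iff_deriv.1 this).2.2
  refine ⟨hC1.continuous, hd, tangent_add_sq_le hd ?_⟩
  have hd2 : ∀ q, HasDerivAt (fun q => deriv (L i) q - γ * q)
      (deriv (deriv (L i)) q - γ * 1) q := fun q =>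
    (hC1.differentiable (by norm_num) q).hasDerivAt.sub ((hasDerivAt_id q).const_mul γ)
  refine monotone_of_deriv_nonneg (fun q => (hd2 q).differentiableAt) fun q => ?_
  have := (h i).2 q
  rw [iteratedDeriv_succ, iteratedDeriv_one] at this
  rw [(hd2 q).deriv]
  linarith

section Relaxed

variable {Λ Λ' : ℝ → ℝ} {γ : ℝ}

/-- Uniformly convex Lagrangians are superlinear. -/
theorem superlinear_of_tangent (hγ : 0 < γ)
    (h : ∀ p q, Λ p + Λ' p * (q - p) + γ / 2 * (q - p) ^ 2 ≤ Λ q) (A : ℝ) :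
    ∃ B, ∀ q, A * |q| - B ≤ Λ q := by
  -- The constant comes from completing the square in the quadratic tangent inequality at `0`.
  refine ⟨(A + |Λ' 0|) ^ 2 / (2 * γ) - Λ 0, fun q => ?_⟩
  have h1 := h 0 q
  rw [sub_zero] at h1
  have h2 : -(|Λ' 0| * |q|) ≤ Λ' 0 * q := by
    rw [← abs_mul]; exact neg_abs_le _
  have h3 : (A + |Λ' 0|) * |q| ≤ (A + |Λ' 0|) ^ 2 / (2 * γ) + γ / 2 * q ^ 2 := by
    have h4 : (A + |Λ' 0|) ^ 2 / (2 * γ) + γ / 2 * q ^ 2 - (A + |Λ' 0|) * |q| =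
        (A + |Λ' 0| - γ * |q|) ^ 2 / (2 * γ) := by
      rw [← sq_abs q]; field_simp; ring
    have : 0 ≤ (A + |Λ' 0| - γ * |q|) ^ 2 / (2 * γ) := by positivity
    linarith
  linarith

/-- The tangent line to `v ↦ Λ (-v)` at `max v v₀`, evaluated at `v`: this is `Λ (-v)` for
`v ≥ v₀`, continued by its tangent line at `v₀`. -/
noncomputable def relaxed (Λ Λ' : ℝ → ℝ) (v₀ v : ℝ) : ℝ :=
  Λ (-max v v₀) - Λ' (-max v v₀) * (v - max v v₀)

theorem relaxed_of_le {v₀ v : ℝ} (h : v₀ ≤ v) : relaxed Λ Λ' v₀ v = Λ (-v) := by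
  rw [relaxed, max_eq_left h]; simp

theorem relaxed_of_ge {v₀ v : ℝ} (h : v ≤ v₀) :
    relaxed Λ Λ' v₀ v = Λ (-v₀) - Λ' (-v₀) * (v - v₀) := by
  rw [relaxed, max_eq_right h]

theorem isTangentMinorant_reflect (hd : ∀ q, HasDerivAt Λ (Λ' q) q) (hc : Continuous Λ')
    (hγ : 0 < γ) (h : ∀ p q, Λ p + Λ' p * (q - p) + γ / 2 * (q - p) ^ 2 ≤ Λ q) :
    IsTangentMinorant Λ (fun v => Λ (-v)) (fun v => -Λ' (-v)) where
  hasDerivAt v := ((hd (-v)).comp v (hasDerivAt_neg v)).congr_deriv (by ring)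
  continuous_deriv := by fun_prop
  tangent_le v w := by
    have h1 := h (-v) (-w)
    have h2 : 0 ≤ γ / 2 * (-w - -v) ^ 2 := by positivity
    linarith

/-- The tangent line of the relaxed cost at `v` is the tangent line of `v ↦ Λ (-v)` at `max v v₀`,
which lies below that function by convexity. -/
theorem isTangentMinorant_relaxed (hd : ∀ q, HasDerivAt Λ (Λ' q) q) (hc : Continuous Λ')
    (hγ : 0 < γ) (h : ∀ p q, Λ p + Λ' p * (q - p) + γ / 2 * (q - p) ^ 2 ≤ Λ q) (v₀ : ℝ) :
    IsTangentMinorant Λ (relaxed Λ Λ' v₀) (fun v => -Λ' (-max v v₀)) where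
  hasDerivAt v := by
    have hR := (isTangentMinorant_reflect hd hc hγ h).hasDerivAt
    have hT : ∀ v, HasDerivAt (fun v => Λ (-v₀) - Λ' (-v₀) * (v - v₀)) (-Λ' (-v₀)) v := fun v =>
      ((((hasDerivAt_id v).sub_const v₀).const_mul (Λ' (-v₀))).const_sub
        (Λ (-v₀))).congr_deriv (by simp)
    rcases lt_trichotomy v v₀ with hv | rfl | hv
    · rw [max_eq_right hv.le]
      refine (hT v).congr_of_eventuallyEq ?_
      filter_upwards [Iio_mem_nhds hv] with w hw
      exact relaxed_of_ge (le_of_lt hw)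
    · rw [max_self, ← hasDerivWithinAt_univ, ← Iic_union_Ici]
      refine HasDerivWithinAt.union ?_ ?_
      · exact (hT v).hasDerivWithinAt.congr (fun w hw => relaxed_of_ge hw) (relaxed_of_ge le_rfl)
      · exact (hR v).hasDerivWithinAt.congr (fun w hw => relaxed_of_le hw) (relaxed_of_le le_rfl)
    · rw [max_eq_left hv.le]
      refine (hR v).congr_of_eventuallyEq ?_
      filter_upwards [Ioi_mem_nhds hv] with w hw
      exact relaxed_of_le (le_of_lt hw)
  continuous_deriv := by fun_prop
  tangent_le v w := by
    have h1 := h (-max v v₀) (-w)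
    have h2 : 0 ≤ γ / 2 * (-w - -max v v₀) ^ 2 := by positivity
    rw [relaxed]
    linarith

theorem isCoerciveFrom_reflect (hγ : 0 < γ)
    (h : ∀ p q, Λ p + Λ' p * (q - p) + γ / 2 * (q - p) ^ 2 ≤ Λ q) (x : ℝ) :
    IsCoerciveFrom (fun v => Λ (-v)) x := by
  intro A
  obtain ⟨B, hB⟩ := superlinear_of_tangent hγ h A
  refine ⟨B, fun r θ _ hθ => ?_⟩
  have h1 := mul_le_mul_of_nonneg_left (hB (-((r - x) / θ))) hθ.le
  rw [abs_neg, abs_div, abs_of_pos hθ] at h1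
  have h2 : θ * (A * (|r - x| / θ) - B) = A * |r - x| - B * θ := by field_simp
  rwa [h2] at h1

/-- The relaxed cost is affine below `v₀`, so it is not superlinear at `-∞`. Displacements from `0`
to `r ≥ 0` have nonnegative velocities, and there the affine piece occupies only a bounded interval.
-/
theorem isCoerciveFrom_relaxed (hγ : 0 < γ)
    (h : ∀ p q, Λ p + Λ' p * (q - p) + γ / 2 * (q - p) ^ 2 ≤ Λ q) {v₀ : ℝ} (hv₀ : 0 ≤ v₀) :
    IsCoerciveFrom (relaxed Λ Λ' v₀) 0 := by
  intro A
  obtain ⟨B, hB⟩ := superlinear_of_tangent hγ h A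
  set D := |B| + (|A| + |Λ' (-v₀)|) * v₀ + |Λ (-v₀)| with hD
  have hlow : ∀ v, 0 ≤ v → A * v - D ≤ relaxed Λ Λ' v₀ v := by
    intro v hv
    have hp : 0 ≤ (|A| + |Λ' (-v₀)|) * v₀ := by positivity
    rcases le_total v₀ v with h1 | h1
    · rw [relaxed_of_le h1]
      have := hB (-v)
      rw [abs_neg, abs_of_nonneg hv] at this
      linarith [le_abs_self B, abs_nonneg (Λ (-v₀))]
    · rw [relaxed_of_ge h1]
      have h2 : A * v ≤ |A| * v₀ := mul_le_mul (le_abs_self A) h1 hv (abs_nonneg A)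
      have h3 : Λ' (-v₀) * (v - v₀) ≤ |Λ' (-v₀)| * v₀ := by
        refine (le_abs_self _).trans ?_
        rw [abs_mul]
        refine mul_le_mul_of_nonneg_left ?_ (abs_nonneg _)
        rw [abs_le]; constructor <;> linarith
      linarith [neg_abs_le (Λ (-v₀)), abs_nonneg B]
  refine ⟨D, fun r θ hr hθ => ?_⟩
  rw [sub_zero]
  have h1 := mul_le_mul_of_nonneg_left (hlow (r / θ) (by positivity)) hθ.le
  have h2 : θ * (A * (r / θ) - D) = A * |r| - D * θ := by
    rw [abs_of_nonneg hr]; field_simp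
  rwa [h2] at h1

/-- Existence of the optimal speed towards a point where waiting costs `ℓ` per unit of time. -/
theorem exists_optimal_speed (hd : ∀ q, HasDerivAt Λ (Λ' q) q) (hc : Continuous Λ') (hγ : 0 < γ)
    (h : ∀ p q, Λ p + Λ' p * (q - p) + γ / 2 * (q - p) ^ 2 ≤ Λ q) {ℓ : ℝ} (hℓ : ℓ ≤ Λ 0) :
    ∃ v₀, 0 ≤ v₀ ∧ relaxed Λ Λ' v₀ 0 = ℓ := by
  set k : ℝ → ℝ := fun v => Λ (-v) + Λ' (-v) * v with hk
  have hΛ : Continuous Λ := continuous_iff_continuousAt.2 fun q => (hd q).continuousAt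
  have hkc : Continuous k := by fun_prop
  -- `k v` is the intercept at `0` of the tangent line at `v`. It starts at `Λ 0 ≥ ℓ`, and the
  -- quadratic gap brings it below `ℓ` at `b`, where `b ≥ 1` allows `b ^ 2` to be replaced by `b`.
  set b := (Λ 0 - ℓ) * 2 / γ + 1 with hb
  have hb1 : 1 ≤ b := by
    have : 0 ≤ (Λ 0 - ℓ) * 2 / γ := div_nonneg (by linarith) hγ.le
    linarith
  have hkb : k b ≤ ℓ := by
    have h1 := h (-b) 0
    have h2 : γ / 2 * b ^ 2 ≥ γ / 2 * b := by
      apply mul_le_mul_of_nonneg_left _ (by positivity); nlinarith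
    have h3 : γ / 2 * b = Λ 0 - ℓ + γ / 2 := by rw [hb]; field_simp
    simp only [hk]
    nlinarith
  obtain ⟨v₀, hv₀, hkv⟩ := intermediate_value_Icc' (by linarith : (0 : ℝ) ≤ b) hkc.continuousOn
    ⟨hkb, show ℓ ≤ k 0 by simpa [hk] using hℓ⟩
  refine ⟨v₀, hv₀.1, ?_⟩
  rw [relaxed_of_ge hv₀.1, ← hkv]
  simp only [hk]
  ring

/-- The relaxed cost is the cost of moving at a constant speed and then waiting. -/
theorem exists_speed_of_relaxed {v₀ ℓ s τ r : ℝ} (hv₀ : 0 ≤ v₀) (hℓ : relaxed Λ Λ' v₀ 0 = ℓ)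
    (hs : s < τ) (hr : 0 ≤ r) : ∃ a τ₁, 0 ≤ a ∧ s ≤ τ₁ ∧ τ₁ ≤ τ ∧ (0 < a ∨ τ₁ = s) ∧
      a * (τ₁ - s) = r ∧
      (τ₁ - s) * Λ (-a) + (τ - τ₁) * ℓ = (τ - s) * relaxed Λ Λ' v₀ ((r - 0) / (τ - s)) := by
  have hθ : 0 < τ - s := sub_pos.2 hs
  rw [sub_zero]
  rcases hr.eq_or_lt with rfl | hr
  · exact ⟨0, s, le_rfl, le_rfl, hs.le, Or.inr rfl, by simp, by simp [hℓ]⟩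
  -- If the average speed is at least `v₀`, no waiting occurs. Otherwise moving at speed `v₀` takes
  -- time `r / v₀`, and the rest is waited; the affine relaxed cost averages the two phases.
  rcases le_or_gt v₀ (r / (τ - s)) with h | h
  · refine ⟨r / (τ - s), τ, by positivity, hs.le, le_rfl, Or.inl (by positivity), ?_, ?_⟩
    · field_simp
    · rw [relaxed_of_le h]; ring
  · have hv : 0 < v₀ := (by positivity : 0 < r / (τ - s)).trans h
    rw [div_lt_iff₀ hθ] at h
    have h1 : r / v₀ ≤ τ - s := by rw [div_le_iff₀ hv]; linarith
    have h0 : 0 ≤ r / v₀ := by positivity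
    refine ⟨v₀, s + r / v₀, hv₀, by linarith, by linarith, Or.inl hv, ?_, ?_⟩
    · field_simp; ring
    · rw [← hℓ, relaxed_of_ge hv₀, relaxed_of_ge (by rw [div_le_iff₀ hθ]; linarith)]
      field_simp
      ring

end Relaxed

/-! ### Explicit trajectories and their actions -/

theorem smul_mem_openBranch (he : ∀ i, ‖e i‖ = 1) (i : Fin N) {r : ℝ} (hr : 0 < r) :
    r • e i ∈ openBranch e i := by
  refine ⟨smul_mem_branch i hr.le, fun h => ?_⟩
  have := norm_smul_unit he i hr.le
  rw [mem_singleton_iff.1 h, norm_zero] at this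
  exact hr.ne this

theorem smul_mem_controlSet (he : ∀ i, ‖e i‖ = 1) (i : Fin N) {r : ℝ} (hr : 0 < r) (p : ℝ) :
    p • e i ∈ controlSet e (r • e i) :=
  Or.inl ⟨i, smul_mem_openBranch he i hr, p, rfl⟩

theorem zero_mem_controlSet (i : Fin N) : (0 : Plane) ∈ controlSet e 0 :=
  Or.inr ⟨rfl, i, 0, le_rfl, by simp⟩

theorem junctionLagrangian_smul (he : ∀ i, ‖e i‖ = 1) (he_inj : Function.Injective e)
    (L : Fin N → ℝ → ℝ) (i : Fin N) {r : ℝ} (hr : 0 < r) (p : ℝ) :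
    junctionLagrangian e L (r • e i) (p • e i) = L i p := by
  have hmem := smul_mem_openBranch he i hr
  rw [junctionLagrangian, if_neg (show ¬r • e i = 0 from hmem.2), Finset.sum_eq_single i]
  · rw [if_pos hmem, inner_smul_right, real_inner_self_eq_norm_sq, he]
    simp
  · rintro k - hk
    refine if_neg ?_
    rintro ⟨⟨ρ, hρ, h⟩, -⟩
    exact hk (eq_of_smul_eq_smul he he_inj hr hρ h).1.symm
  · simp

theorem junctionLagrangian_zero (L : Fin N → ℝ → ℝ) :
    junctionLagrangian e L 0 0 = ⨅ j, L j 0 := by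
  rw [junctionLagrangian, if_pos rfl, norm_zero]

theorem integral_of_eqOn_const {f : ℝ → ℝ} {a b c : ℝ} (hab : a ≤ b)
    (h : ∀ r ∈ Ioo a b, f r = c) :
    IntervalIntegrable f volume a b ∧ ∫ r in a..b, f r = (b - a) * c := by
  constructor
  · refine (intervalIntegrable_const (c := c)).congr_uIoo ?_
    rw [uIoo_of_le hab]
    exact fun r hr => (h r hr).symm
  · rw [intervalIntegral.integral_congr_Ioo_of_le (g := fun _ => c) hab h]
    simp

theorem absolutelyContinuous_of_dist_le {X : ℝ → Plane} {K : ℝ} (hK : 0 ≤ K)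
    (h : ∀ r r', ‖X r - X r'‖ ≤ K * |r - r'|) (s t : ℝ) : AbsolutelyContinuousOnInterval X s t := by
  have : LipschitzWith ⟨K, hK⟩ X := LipschitzWith.of_dist_le_mul fun r r' => by
    rw [dist_eq_norm, Real.dist_eq]; exact h r r'
  exact this.lipschitzOnWith.absolutelyContinuousOnInterval

/-- The trajectory moving on one branch with constant speed. -/
theorem exists_straight_trajectory (he : ∀ i, ‖e i‖ = 1) (he_inj : Function.Injective e)
    (L : Fin N → ℝ → ℝ) (j : Fin N) {s t r x : ℝ} (hst : s < t) (hr : 0 ≤ r) (hx : 0 < x) :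
    ∃ X ∈ trajectories e s (r • e j) t (x • e j),
      action e L s t X = (((t - s) * L j ((x - r) / (t - s)) : ℝ) : EReal) := by
  have hpos : 0 < t - s := sub_pos.2 hst
  set p := (x - r) / (t - s) with hp
  have hpx : p * (t - s) = x - r := by rw [hp]; field_simp
  set X : ℝ → Plane := fun τ => (r + (τ - s) * p) • e j with hX
  have hderiv : ∀ τ, deriv X τ = p • e j := fun τ => by
    have h1 : HasDerivAt (fun τ => r + (τ - s) * p) p τ :=
      ((((hasDerivAt_id τ).sub_const s).mul_const p).const_add r).congr_deriv (one_mul p)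
    exact (h1.smul_const (e j)).deriv
  have hin : ∀ τ ∈ Ioo s t, 0 < r + (τ - s) * p := by
    intro τ hτ
    -- The position is a convex combination of `r ≥ 0` and `x > 0`, hence positive after time `s`.
    have h1 : (r + (τ - s) * p) * (t - s) = (t - τ) * r + (τ - s) * x := by
      linear_combination (τ - s) * hpx
    have h2 : 0 < (t - τ) * r + (τ - s) * x :=
      add_pos_of_nonneg_of_pos (mul_nonneg (sub_pos.2 hτ.2).le hr) (mul_pos (sub_pos.2 hτ.1) hx)
    rw [← h1] at h2
    exact pos_of_mul_pos_left h2 hpos.le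
  refine ⟨X, ⟨?_, ?_, ?_, ?_, ?_⟩, ?_⟩
  · refine absolutelyContinuous_of_dist_le (abs_nonneg p) (fun τ τ' => le_of_eq ?_) s t
    simp only [hX]
    rw [← sub_smul, norm_smul, he, mul_one, Real.norm_eq_abs, ← abs_mul]
    congr 1
    ring
  · exact fun τ hτ => smul_mem_junction j (hin τ hτ).le
  · refine ae_restrict_of_forall_mem measurableSet_Ioo fun τ hτ => ?_
    rw [hderiv]
    exact smul_mem_controlSet he j (hin τ hτ) p
  · simp [hX]
  · simp only [hX]
    congr 1
    linear_combination hpx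
  · obtain ⟨h1, h2⟩ := integral_of_eqOn_const (c := L j p) hst.le
      (f := fun τ => junctionLagrangian e L (X τ) (deriv X τ)) fun τ hτ => by
        rw [hderiv]
        exact junctionLagrangian_smul he he_inj L j (hin τ hτ) p
    rw [action, if_pos h1, h2]

/-- The trajectory moving to the junction point with constant speed, waiting there, and leaving
with constant speed. -/
theorem exists_junction_trajectory (he : ∀ i, ‖e i‖ = 1) (he_inj : Function.Injective e)
    (L : Fin N → ℝ → ℝ) (i j : Fin N) {s τ₁ τ₂ t a b : ℝ} (h₁ : s ≤ τ₁) (h₁₂ : τ₁ ≤ τ₂)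
    (h₂ : τ₂ ≤ t) (ha : 0 ≤ a) (hb : 0 ≤ b) (ha' : 0 < a ∨ τ₁ = s) (hb' : 0 < b ∨ τ₂ = t) :
    ∃ X ∈ trajectories e s ((a * (τ₁ - s)) • e i) t ((b * (t - τ₂)) • e j),
      action e L s t X = (((τ₁ - s) * L i (-a) + (τ₂ - τ₁) * (⨅ k, L k 0) +
        (t - τ₂) * L j b : ℝ) : EReal) := by
  set X : ℝ → Plane := fun τ => (a * max (τ₁ - τ) 0) • e i + (b * max (τ - τ₂) 0) • e j with hX
  have hX1 : ∀ τ, τ ≤ τ₁ → X τ = (a * (τ₁ - τ)) • e i := by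
    intro τ hτ
    simp [hX, max_eq_left (sub_nonneg.2 hτ), max_eq_right (sub_nonpos.2 (hτ.trans h₁₂))]
  have hX2 : ∀ τ ∈ Icc τ₁ τ₂, X τ = 0 := by
    intro τ hτ
    simp [hX, max_eq_right (sub_nonpos.2 hτ.1), max_eq_right (sub_nonpos.2 hτ.2)]
  have hX3 : ∀ τ, τ₂ ≤ τ → X τ = (b * (τ - τ₂)) • e j := by
    intro τ hτ
    simp [hX, max_eq_left (sub_nonneg.2 hτ), max_eq_right (sub_nonpos.2 (h₁₂.trans hτ))]
  have hd1 : ∀ τ, τ < τ₁ → deriv X τ = (-a) • e i := by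
    intro τ hτ
    have h : HasDerivAt (fun τ => a * (τ₁ - τ)) (-a) τ :=
      (((hasDerivAt_id τ).const_sub τ₁).const_mul a).congr_deriv (by ring)
    refine ((h.smul_const (e i)).congr_of_eventuallyEq ?_).deriv
    filter_upwards [Iio_mem_nhds hτ] with τ' hτ' using hX1 τ' (le_of_lt hτ')
  have hd2 : ∀ τ ∈ Ioo τ₁ τ₂, deriv X τ = 0 := by
    intro τ hτ
    refine ((hasDerivAt_const τ (0 : Plane)).congr_of_eventuallyEq ?_).deriv
    filter_upwards [Ioo_mem_nhds hτ.1 hτ.2] with τ' hτ' using hX2 τ' ⟨hτ'.1.le, hτ'.2.le⟩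
  have hd3 : ∀ τ, τ₂ < τ → deriv X τ = b • e j := by
    intro τ hτ
    have h : HasDerivAt (fun τ => b * (τ - τ₂)) b τ :=
      (((hasDerivAt_id τ).sub_const τ₂).const_mul b).congr_deriv (mul_one b)
    refine ((h.smul_const (e j)).congr_of_eventuallyEq ?_).deriv
    filter_upwards [Ioi_mem_nhds hτ] with τ' hτ' using hX3 τ' (le_of_lt hτ')
  -- A moving phase of positive duration has positive speed. With zero speed it would sit at the
  -- junction point, where the cost is the waiting cost and not `L i 0`.
  have hp1 : ∀ τ ∈ Ioo s τ₁, 0 < a * (τ₁ - τ) := fun τ hτ =>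
    mul_pos (ha'.resolve_right (hτ.1.trans hτ.2).ne') (sub_pos.2 hτ.2)
  have hp3 : ∀ τ ∈ Ioo τ₂ t, 0 < b * (τ - τ₂) := fun τ hτ =>
    mul_pos (hb'.resolve_right (hτ.1.trans hτ.2).ne) (sub_pos.2 hτ.1)
  refine ⟨X, ⟨?_, ?_, ?_, hX1 s h₁, hX3 t h₂⟩, ?_⟩
  · refine absolutelyContinuous_of_dist_le (add_nonneg ha hb) (fun τ τ' => ?_) s t
    have e1 : X τ - X τ' = (a * (max (τ₁ - τ) 0 - max (τ₁ - τ') 0)) • e i +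
        (b * (max (τ - τ₂) 0 - max (τ' - τ₂) 0)) • e j := by
      simp only [hX, mul_sub, sub_smul]; abel
    have e2 := abs_max_sub_max_le_abs (τ₁ - τ) (τ₁ - τ') 0
    have e3 := abs_max_sub_max_le_abs (τ - τ₂) (τ' - τ₂) 0
    rw [sub_sub_sub_cancel_left, abs_sub_comm τ' τ] at e2
    rw [sub_sub_sub_cancel_right] at e3
    rw [e1, add_mul]
    refine (norm_add_le _ _).trans (add_le_add ?_ ?_)
    · rw [norm_smul, he, mul_one, Real.norm_eq_abs, abs_mul, abs_of_nonneg ha]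
      exact mul_le_mul_of_nonneg_left e2 ha
    · rw [norm_smul, he, mul_one, Real.norm_eq_abs, abs_mul, abs_of_nonneg hb]
      exact mul_le_mul_of_nonneg_left e3 hb
  · intro τ _
    rcases le_total τ τ₁ with h | h
    · rw [hX1 τ h]
      exact smul_mem_junction i (mul_nonneg ha (sub_nonneg.2 h))
    rcases le_total τ τ₂ with h' | h'
    · rw [hX2 τ ⟨h, h'⟩, ← zero_smul ℝ (e i)]
      exact smul_mem_junction i le_rfl
    · rw [hX3 τ h']
      exact smul_mem_junction j (mul_nonneg hb (sub_nonneg.2 h'))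
  · rw [ae_restrict_iff' measurableSet_Ioo]
    -- Differentiability may fail at the two switching times, which form a null set.
    filter_upwards [(toFinite {τ₁, τ₂}).measure_zero volume |> compl_mem_ae_iff.2] with τ hne hτ
    simp only [mem_compl_iff, mem_insert_iff, mem_singleton_iff, not_or] at hne
    rcases lt_or_gt_of_ne hne.1 with h | h
    · rw [hd1 τ h, hX1 τ h.le]
      exact smul_mem_controlSet he i (hp1 τ ⟨hτ.1, h⟩) _
    rcases lt_or_gt_of_ne hne.2 with h' | h'
    · rw [hd2 τ ⟨h, h'⟩, hX2 τ ⟨h.le, h'.le⟩]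
      exact zero_mem_controlSet i
    · rw [hd3 τ h', hX3 τ h'.le]
      exact smul_mem_controlSet he j (hp3 τ ⟨h', hτ.2⟩) _
  · obtain ⟨i1, v1⟩ := integral_of_eqOn_const (c := L i (-a)) h₁
      (f := fun τ => junctionLagrangian e L (X τ) (deriv X τ)) fun τ hτ => by
        rw [hd1 τ hτ.2, hX1 τ hτ.2.le]
        exact junctionLagrangian_smul he he_inj L i (hp1 τ hτ) _
    obtain ⟨i2, v2⟩ := integral_of_eqOn_const (c := ⨅ k, L k 0) h₁₂
      (f := fun τ => junctionLagrangian e L (X τ) (deriv X τ)) fun τ hτ => by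
        rw [hd2 τ hτ, hX2 τ ⟨hτ.1.le, hτ.2.le⟩]
        exact junctionLagrangian_zero L
    obtain ⟨i3, v3⟩ := integral_of_eqOn_const (c := L j b) h₂
      (f := fun τ => junctionLagrangian e L (X τ) (deriv X τ)) fun τ hτ => by
        rw [hd3 τ hτ.1, hX3 τ hτ.1.le]
        exact junctionLagrangian_smul he he_inj L j (hp3 τ hτ) _
    rw [action, if_pos ((i1.trans i2).trans i3),
      ← intervalIntegral.integral_add_adjacent_intervals (i1.trans i2) i3,
      ← intervalIntegral.integral_add_adjacent_intervals i1 i2, v1, v2, v3]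

/-! ### Optimal trajectories -/

/-- Super-optimality from the junction point. -/
theorem exists_optimal_from_junction (he : ∀ i, ‖e i‖ = 1) (he_inj : Function.Injective e)
    (i₀ : Fin N) {L : Fin N → ℝ → ℝ} (hL : UniformlyConvexLagrangians L) {T : ℝ}
    {u : ℝ → Plane → ℝ} (hu : IsSuperSolution e L T u) {s t C : ℝ} (hs : 0 ≤ s) (hst : s < t)
    (htT : t < T) (hC : 0 ≤ C)
    (hlow : ∀ τ ∈ Ico s T, ∀ i, ∀ r : ℝ, 0 ≤ r → -C * (1 + r) ≤ u τ (r • e i)) :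
    ∃ i a τ₁, 0 ≤ a ∧ s ≤ τ₁ ∧ τ₁ ≤ t ∧ (0 < a ∨ τ₁ = s) ∧
      u s ((a * (τ₁ - s)) • e i) + ((τ₁ - s) * L i (-a) + (t - τ₁) * ⨅ k, L k 0) ≤ u t 0 := by
  obtain ⟨γ, hγ, L', hL'⟩ := hL.exists_deriv
  -- The speeds are chosen so that all relaxed costs equal `min_k L_k(0)` at velocity `0`, which
  -- makes the test function continuous at the junction point.
  choose v₀ hv₀ hv using fun i => exists_optimal_speed (hL' i).2.1 (hL' i).1 hγ (hL' i).2.2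
    (ciInf_le (finite_range fun k => L k 0).bddBelow i)
  set M : Fin N → ℝ → ℝ := fun i => relaxed (L i) (L' i) (v₀ i) with hMdef
  have hM := fun i => isTangentMinorant_relaxed (hL' i).2.1 (hL' i).1 hγ (hL' i).2.2 (v₀ i)
  have hco : ∀ i, IsCoerciveFrom (M i) 0 := fun i =>
    isCoerciveFrom_relaxed hγ (hL' i).2.2 (hv₀ i)
  have hM0 : ∀ i, M i 0 = M i₀ 0 := fun i => (hv i).trans (hv i₀).symm
  have hε := tendsto_one_div_add_atTop_nhds_zero_nat (𝕜 := ℝ)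
  have happ : ∀ᶠ n : ℕ in atTop, ∃ i τ r, τ ∈ Ico s (t + 1 / ((n : ℝ) + 1)) ∧ 0 ≤ r ∧
      (τ, r) ∈ {p : ℝ × ℝ | p.1 = s} ∧
      u τ (r • e i) + (t + 1 / ((n : ℝ) + 1) - τ) * M i ((r - 0) / (t + 1 / ((n : ℝ) + 1) - τ)) ≤
        u t 0 + 1 / ((n : ℝ) + 1) * (M i₀ 0 + t + 1) := by
    filter_upwards [hε.eventually_lt_const (sub_pos.2 htT)] with n hn
    have hpos : 0 < 1 / ((n : ℝ) + 1) := by positivity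
    obtain ⟨i, r, hr, h⟩ := exists_approx_junction he he_inj i₀ hu hs hst hC hlow hM hco hM0 hpos
      (by linarith)
    exact ⟨i, s, r, ⟨le_rfl, by linarith⟩, hr, rfl, h⟩
  -- The branch may depend on `n`; as there are finitely many, one of them recurs infinitely often.
  obtain ⟨i, hi⟩ := frequently_exists.1 happ.frequently
  obtain ⟨τ, r, hτ, hr, hτs, h⟩ := exists_of_frequently_approx hu hs htT hC i
    (fun τ hτ => hlow τ hτ i) (hM i).contDiff.continuous (hco i)
    (isClosed_eq continuous_fst continuous_const) (fun h : t = s => hst.ne' h) hε hi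
  obtain rfl : τ = s := hτs
  obtain ⟨a, τ₁, ha, h1, h2, h3, rfl, h4⟩ := exists_speed_of_relaxed (hv₀ i) (hv i) hst hr
  refine ⟨i, a, τ₁, ha, h1, h2, h3, ?_⟩
  rw [h4]
  exact h

/-- Super-optimality along a branch, up to the junction point. -/
theorem exists_optimal_on_branch (he : ∀ i, ‖e i‖ = 1) (he_inj : Function.Injective e)
    {L : Fin N → ℝ → ℝ} (hL : UniformlyConvexLagrangians L) {T : ℝ}
    {u : ℝ → Plane → ℝ} (hu : IsSuperSolution e L T u) {s t x C : ℝ} (hs : 0 ≤ s) (hst : s < t)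
    (htT : t < T) (hC : 0 ≤ C) (j : Fin N) (hx : 0 < x)
    (hlow : ∀ τ ∈ Ico s T, ∀ r : ℝ, 0 ≤ r → -C * (1 + r) ≤ u τ (r • e j)) :
    ∃ τ r, τ ∈ Ico s t ∧ 0 ≤ r ∧ (τ = s ∨ r = 0) ∧
      u τ (r • e j) + (t - τ) * L j ((x - r) / (t - τ)) ≤ u t (x • e j) := by
  obtain ⟨γ, hγ, L', hL'⟩ := hL.exists_deriv
  have hM := isTangentMinorant_reflect (hL' j).2.1 (hL' j).1 hγ (hL' j).2.2
  have hco := isCoerciveFrom_reflect hγ (hL' j).2.2 x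
  have hε := tendsto_one_div_add_atTop_nhds_zero_nat (𝕜 := ℝ)
  have happ : ∀ᶠ n : ℕ in atTop, ∃ τ r, τ ∈ Ico s (t + 1 / ((n : ℝ) + 1)) ∧ 0 ≤ r ∧
      (τ, r) ∈ {p : ℝ × ℝ | p.1 = s ∨ p.2 = 0} ∧
      u τ (r • e j) + (t + 1 / ((n : ℝ) + 1) - τ) *
        L j (-((r - x) / (t + 1 / ((n : ℝ) + 1) - τ))) ≤
        u t (x • e j) + 1 / ((n : ℝ) + 1) * (L j (-0) + t + 1) := by
    filter_upwards [hε.eventually_lt_const (sub_pos.2 htT)] with n hn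
    exact exists_approx_branch he he_inj hu hs hst hC j hlow hM hco hx.le (by positivity)
      (by linarith)
  obtain ⟨τ, r, hτ, hr, hτr, h⟩ := exists_of_frequently_approx hu hs htT hC j hlow
    hM.contDiff.continuous hco
    ((isClosed_eq continuous_fst continuous_const).union
      (isClosed_eq continuous_snd continuous_const))
    (by rintro (h | h); exacts [hst.ne' h, hx.ne' h]) hε happ.frequently
  refine ⟨τ, r, hτ, hr, hτr, ?_⟩
  rwa [show (x - r) / (t - τ) = -((r - x) / (t - τ)) by rw [← neg_div, neg_sub]]

/-- Super-optimality of super-solutions, with an optimal trajectory. -/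
theorem exists_optimal_trajectory (he : ∀ i, ‖e i‖ = 1) (he_inj : Function.Injective e)
    {L : Fin N → ℝ → ℝ} (hL : UniformlyConvexLagrangians L) {T : ℝ}
    {u : ℝ → Plane → ℝ} (hu : IsSuperSolution e L T u) {s t C : ℝ} (hs : 0 ≤ s) (hst : s < t)
    (htT : t < T) (hC : 0 ≤ C)
    (hlow : ∀ τ ∈ Ico s T, ∀ i, ∀ r : ℝ, 0 ≤ r → -C * (1 + r) ≤ u τ (r • e i))
    {x : Plane} (hx : x ∈ junction e) :
    ∃ y ∈ junction e, ∃ X ∈ trajectories e s y t x, ∃ c : ℝ, action e L s t X = (c : EReal) ∧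
      u s y + c ≤ u t x := by
  obtain ⟨j, x, hx0, rfl⟩ := mem_junction_iff.1 hx
  rcases hx0.eq_or_lt with rfl | hx0
  · obtain ⟨i, a, τ₁, ha, h1, h2, h3, h4⟩ :=
      exists_optimal_from_junction he he_inj j hL hu hs hst htT hC hlow
    obtain ⟨X, hX, hXc⟩ := exists_junction_trajectory he he_inj L i j h1 h2 le_rfl ha le_rfl h3
      (Or.inr rfl)
    refine ⟨_, smul_mem_junction i (mul_nonneg ha (sub_nonneg.2 h1)), X, by simpa using hX, _,
      hXc, ?_⟩
    rw [zero_smul, sub_self, zero_mul, add_zero]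
    exact h4
  obtain ⟨τ, r, hτ, hr, hτr, h⟩ := exists_optimal_on_branch he he_inj hL hu hs hst htT hC j hx0
    fun τ hτ => hlow τ hτ j
  rcases hτ.1.eq_or_lt with rfl | hsτ
  · obtain ⟨X, hX, hXc⟩ := exists_straight_trajectory he he_inj L j hst hr hx0
    exact ⟨_, smul_mem_junction j hr, X, hX, _, hXc, h⟩
  -- The backward path hits the junction point at a time `τ > s`. Super-optimality there on `[s, τ]`
  -- gives the earlier piece, and one trajectory realizes approach, waiting and exit.
  · obtain rfl : r = 0 := hτr.resolve_left hsτ.ne'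
    rw [zero_smul, sub_zero] at h
    obtain ⟨i, a, τ₁, ha, h1, h2, h3, h4⟩ :=
      exists_optimal_from_junction he he_inj j hL hu hs hsτ (hτ.2.trans htT) hC hlow
    have hpos : 0 < t - τ := sub_pos.2 hτ.2
    obtain ⟨X, hX, hXc⟩ := exists_junction_trajectory he he_inj L i j h1 h2 hτ.2.le ha
      (show 0 ≤ x / (t - τ) by positivity) h3 (Or.inl (by positivity))
    rw [div_mul_cancel₀ _ hpos.ne'] at hX
    exact ⟨_, smul_mem_junction i (mul_nonneg ha (sub_nonneg.2 h1)), X, hX, _, hXc, by linarith⟩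

end JunctionHJ

/-! ### The proposition -/

open JunctionHJ
theorem proposition5p1 {N : ℕ} (hN : 1 ≤ N)
    (e : Fin N → Plane) (he : ∀ i, ‖e i‖ = 1) (he_inj : Function.Injective e)
    (L : Fin N → ℝ → ℝ) (hL : UniformlyConvexLagrangians L)
    (T : ℝ) (hT : 0 < T) (u : ℝ → Plane → ℝ) (hu : IsSuperSolution e L T u)
    (σ : ℝ) (hσ : 0 < σ)
    (hlin : ∀ t ∈ Set.Ioo 0 T, ∀ x ∈ junction e, -σ * (1 + geoDist e x 0) ≤ u t x) :
    (∀ t ∈ Set.Ioo 0 T, ∀ x ∈ junction e, ∀ s ∈ Set.Ioc 0 t,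
      (⨅ y ∈ junction e, ((u s y : ℝ) : EReal) + minimalAction e L s y t x) ≤
        ((u t x : ℝ) : EReal)) ∧
    (∀ u₀ : Plane → ℝ, LipschitzOnJunction e u₀ → IsCauchySuperSolution e L T u₀ u →
      ∀ t ∈ Set.Ico 0 T, ∀ x ∈ junction e,
        valueFunction e L u₀ t x ≤ ((u t x : ℝ) : EReal)) := by
  have hlow : ∀ τ ∈ Ioo 0 T, ∀ i, ∀ r : ℝ, 0 ≤ r → -σ * (1 + r) ≤ u τ (r • e i) := by
    intro τ hτ i r hr
    have := hlin τ hτ _ (smul_mem_junction i hr)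
    rwa [geoDist_zero he i hr] at this
  constructor
  · intro t ht x hx s hs
    rcases hs.2.eq_or_lt with rfl | hst
    · refine iInf₂_le_of_le x hx ?_
      simp [minimalAction]
    · obtain ⟨y, hy, X, hX, c, hXc, hc⟩ := exists_optimal_trajectory he he_inj hL hu hs.1.le hst
        ht.2 hσ.le (fun τ hτ => hlow τ ⟨hs.1.trans_le hτ.1, hτ.2⟩) hx
      refine iInf₂_le_of_le y hy ?_
      have h1 : minimalAction e L s y t x ≤ (c : EReal) := by
        rw [minimalAction, if_neg hst.ne, ← hXc]
        exact iInf₂_le X hX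
      refine (add_le_add le_rfl h1).trans ?_
      exact_mod_cast hc
  · rintro u₀ ⟨K, hK⟩ ⟨-, hu₀⟩ t ht x hx
    rcases ht.1.eq_or_lt with rfl | ht0
    · refine iInf₂_le_of_le x hx (iInf₂_le_of_le (fun _ => x) ⟨?_, ?_, ?_, rfl, rfl⟩ ?_)
      · exact absolutelyContinuous_of_dist_le le_rfl (by simp) 0 0
      · exact fun _ _ => hx
      · simp
      · rw [action, if_pos IntervalIntegrable.refl, intervalIntegral.integral_same]
        simpa using hu₀ x hx
    -- The linear lower bound is assumed only for positive times. At time `0` it follows from `u ≥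
    -- u₀` and the Lipschitz bound, so `s = 0` becomes admissible.
    · have hlow' : ∀ τ ∈ Ico 0 T, ∀ i, ∀ r : ℝ, 0 ≤ r →
          -(σ + |u₀ 0| + |K|) * (1 + r) ≤ u τ (r • e i) := by
        intro τ hτ i r hr
        have hp1 : 0 ≤ |u₀ 0| * r := by positivity
        have hp2 : 0 ≤ σ * r := by positivity
        have hp3 := abs_nonneg K
        rcases hτ.1.eq_or_lt with rfl | hτ0
        · have h1 := hu₀ _ (smul_mem_junction i hr)
          have h2 := hK _ (smul_mem_junction i hr) _ (smul_mem_junction i le_rfl)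
          rw [geoDist_smul_smul he i hr le_rfl, sub_zero, abs_of_nonneg hr, zero_smul] at h2
          have h3 := (abs_le.1 h2).1
          have h4 : K * r ≤ |K| * r := mul_le_mul_of_nonneg_right (le_abs_self K) hr
          linarith [neg_abs_le (u₀ 0)]
        · have h1 := hlow τ ⟨hτ0, hτ.2⟩ i r hr
          have h4 : 0 ≤ |K| * r := by positivity
          linarith [abs_nonneg (u₀ 0)]
      obtain ⟨y, hy, X, hX, c, hXc, hc⟩ := exists_optimal_trajectory he he_inj hL hu le_rfl ht0
        ht.2 (by positivity) hlow' hx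
      refine iInf₂_le_of_le y hy (iInf₂_le_of_le X hX ?_)
      rw [hXc]
      have := hu₀ y hy
      exact_mod_cast (by linarith : u₀ y + c ≤ u t x)
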